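/- \textbf{Conventions.} Let $n$ be a natural number and $I=\{1,\dots,n,-n,\dots,-1\}$, with $\varepsilon_i=1$ for $i>0$ and $\varepsilon_i=-1$ for $i<0$. Matrices in the symplectic group $\mathrm{Sp}(2n,R)$ over a commutative ring $R$ are indexed by $I$; thus $a\in \mathrm{GL}(2n,R)$ is symplectic iff $a'_{ij}=\varepsilon_i\varepsilon_j a_{-j,-i}$ for all $i,j$, where $a'_{ij}$ are the entries of $a^{-1}$. Put $T_{ij}(\xi)=e+\xi e_{ij}-\varepsilon_i\varepsilon_j\xi e_{-j,-i}$ for $i\ne\pm j$ (short transvections), $T_{i,-i}(\alpha)=e+\alpha e_{i,-i}$ (long transvections), and $S_{i,-i}(g)=\sum_{j>0}g_{ij}g'_{j,-i}$ for $g\in\mathrm{Sp}(2n,R)$. An equivalence relation $\nu$ on $I$ is \emph{unitary} if $i\sim j$ implies $-i\sim -j$. A class $C$ is \emph{self-conjugate} if $-C=C$. Let $h(\nu)\in(\mathbb N\cup\{\infty\})^2$ be the pair (minimum size of a self-conjugate class, minimum size of a non-self-conjugate class), the minimum of the empty family being $\infty$; pairs are compared coordinatewise. A \emph{form net of ideals}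 $(\sigma,\Gamma)$ over a commutative ring $A$ consists of ideals $\sigma_{ij}$ of $A$ ($i,j\in I$) and additive subgroups $\Gamma_i$ of $A$ ($i\in I$) such that, for all $i,j,k\in I$: $\sigma_{ik}\sigma_{kj}\subseteq\sigma_{ij}$; $\sigma_{ij}=\sigma_{-j,-i}$; $\sigma_{ii}=A$; $2\sigma_{i,-i}\subseteq\Gamma_i\subseteq\sigma_{i,-i}$; and $\xi^2\alpha\in\Gamma_i$ for all $\xi\in\sigma_{ij}$, $\alpha\in\Gamma_j$. It is \emph{exact} if $\sigma_{i,-i}=\sum_{k\ne\pm i}\sigma_{ik}\sigma_{k,-i}+\langle\Gamma_i\rangle$ for all $i$, where $\langle\Gamma_i\rangle$ is the ideal generated by $\Gamma_i$, and \emph{major} with respect to $\nu$ if $\sigma_{ij}=A$ whenever $i\sim j$ and $\Gamma_i=A$ whenever $i\sim -i$. For a form net $(\sigma,\Gamma)$ over $R$ put $$\mathrm{Sp}(\sigma,\Gamma)=\{g\in \mathrm{Sp}(2n,R)\mid g_{ij}\in\sigma_{ij}\text{ and } S_{i,-i}(g)\in\Gamma_i\text{ for all }i,j\in I\}.$$ A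 \emph{standard setting} $(R,R',S)$ consists of a commutative ring $R$, a unital subring $R'\subseteq R$ and a subset $S\subseteq R'\cap R^*$ such that for every $\xi\in R$ there is $x\in S$ with $x\xi\in R'$. Let $(\sigma',\Gamma')$ be a form net over $R'$. The $(\sigma',\Gamma')$-\emph{elementary transvections} are the matrices $T_{ij}(\xi)$ with $i\neq\pm j$, $\xi\in\sigma'_{ij}$, and $T_{i,-i}(\alpha)$ with $\alpha\in\Gamma'_i$; they generate the subgroup $\mathrm{Ep}(\sigma',\Gamma')$ of $\mathrm{Sp}(2n,R)$. The $S$-\emph{closure} of $(\sigma',\Gamma')$ is the form net $(\sigma,\Gamma)$ over $R$ given by $$\sigma_{ij}=\{\xi\in R\mid \exists x\in S:\ x\xi\in\sigma'_{ij}\},\qquad \Gamma_i=\{\alpha\in R\mid\exists x\in S:\ x^2\alpha\in\Gamma'_i\}.$$ The net $(\sigma',\Gamma')$ is \emph{$S$-associated} with a subgroup $H\le\mathrm{Sp}(2n,R)$ if $\mathrm{Ep}(\sigma',\Gamma')\le H$; whenever $T_{sr}(\xi)\in H$ with $s\ne\pm r$, $\xi\in R$, there is $x\in S$ with $x\xi\in\sigma'_{sr}$;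 and whenever $T_{s,-s}(\alpha)\in H$ with $\alpha\in R$, there is $x\in S$ with $x^2\alpha\in\Gamma'_s$. \textbf{Theorem.} Let $(R,R',S)$ be a standard setting with $R$ a local ring, and let $\nu$ be a unitary equivalence relation on $I$ with $h(\nu)\ge(4,5)$. Let $H$ be a subgroup of $\mathrm{Sp}(2n,R)$, let $(\sigma',\Gamma')$ be an exact form net of ideals over $R'$ which is major with respect to $\nu$ and $S$-associated with $H$, and let $(\sigma,\Gamma)$ be its $S$-closure in $R$. Then for every $a\in H$ and every (short or long) $(\sigma',\Gamma')$-elementary transvection $T_{sr}(\xi)$ one has $aT_{sr}(\xi)a^{-1}\in\mathrm{Sp}(\sigma,\Gamma)$. In other words, $$H\le\mathrm{Transp}_{\mathrm{Sp}(2n,R)}(\mathrm{Ep}(\sigma',\Gamma'),\mathrm{Sp}(\sigma,\Gamma))=\{a\in\mathrm{Sp}(2n,R)\mid a\tau a^{-1}\in\mathrm{Sp}(\sigma,\Gamma)\text{ for all }\tau\in\mathrm{Ep}(\sigma',\Gamma')\}.$$ -/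

import Mathlib

namespace SpNet

/-- The index set `{1, …, n, -n, …, -1}`: `Sum.inl k` is the `k`-th positive index and
`Sum.inr k` is its negative. -/
abbrev Idx (n : ℕ) : Type := Fin n ⊕ Fin n

/-- The index `-i`. -/
abbrev opp {n : ℕ} (i : Idx n) : Idx n := Sum.swap i

/-- The sign `ε_i` of an index, as an element of `R`. -/
def sgn (R : Type*) [CommRing R] {n : ℕ} (i : Idx n) : R := Sum.elim (fun _ => 1) (fun _ => -1) i

/-- The symplectic group `Sp(2n, R)`. -/
abbrev Sp (n : ℕ) (R : Type*) [CommRing R] : Type _ := Matrix.symplecticGroup (Fin n) R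

section Transvections

variable {R : Type*} [CommRing R] {n : ℕ}

/-- The matrix `e + ξ e_{ij} - ε_i ε_j ξ e_{-j,-i}`. -/
def shortMatrix (i j : Idx n) (ξ : R) : Matrix (Idx n) (Idx n) R :=
  1 + Matrix.single i j ξ - Matrix.single (opp j) (opp i) (sgn R i * sgn R j * ξ)

/-- The matrix `e + α e_{i,-i}`. -/
def longMatrix (i : Idx n) (α : R) : Matrix (Idx n) (Idx n) R :=
  1 + Matrix.single i (opp i) α

theorem sgn_mul_self (i : Idx n) : sgn R i * sgn R i = 1 := by
  cases i <;> simp [sgn]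

theorem sgn_opp (i : Idx n) : sgn R (opp i) = - sgn R i := by
  cases i <;> simp [sgn]

theorem opp_opp (i : Idx n) : opp (opp i) = i := Sum.swap_swap i

theorem opp_eq_iff (i j : Idx n) : opp i = opp j ↔ i = j :=
  Sum.swap_leftInverse.injective.eq_iff

theorem J_apply (i j : Idx n) :
    Matrix.J (Fin n) R i j = if j = opp i then - sgn R i else 0 := by
  rcases i with i | i <;> rcases j with j | j <;>
    simp [Matrix.J, sgn, Matrix.one_apply, eq_comm, Matrix.neg_apply]
  split_ifs <;> simp

theorem single_mul_J (i j : Idx n) (c : R) :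
    Matrix.single i j c * Matrix.J (Fin n) R = Matrix.single i (opp j) (-(sgn R j * c)) := by
  ext a b
  by_cases h : a = i
  · subst h
    rw [Matrix.single_mul_apply_same, J_apply, Matrix.single_apply]
    by_cases hb : b = opp j
    · subst hb; simp [mul_comm]
    · simp [hb, Ne.symm hb]
  · rw [Matrix.single_mul_apply_of_ne _ _ _ _ _ h, Matrix.single_apply]
    simp [Ne.symm h]

theorem J_mul_single (i j : Idx n) (c : R) :
    Matrix.J (Fin n) R * Matrix.single i j c = Matrix.single (opp i) j (sgn R i * c) := by
  ext a b
  by_cases h : b = j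
  · subst h
    rw [Matrix.mul_single_apply_same, J_apply, Matrix.single_apply]
    by_cases ha : opp i = a
    · subst ha; simp [sgn_opp]
    · have : ¬ i = opp a := fun hh => ha (by rw [hh, opp_opp])
      simp [ha, this]
  · rw [Matrix.mul_single_apply_of_ne _ _ _ _ _ h, Matrix.single_apply]
    simp [Ne.symm h]

theorem single_neg' (i j : Idx n) (c : R) :
    Matrix.single i j (-c) = -Matrix.single i j c := by
  ext a b
  simp only [Matrix.single_apply, Matrix.neg_apply]
  split_ifs <;> simp

theorem ne_opp (i : Idx n) : i ≠ opp i := by cases i <;> simp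

theorem shortMatrix_mem (i j : Idx n) (hij : i ≠ j) (ξ : R) :
    shortMatrix i j ξ ∈ Matrix.symplecticGroup (Fin n) R := by
  have h1 : opp j ≠ opp i := fun h => hij ((opp_eq_iff _ _).1 h).symm
  have e1 : sgn R i * (sgn R i * sgn R j * ξ) = sgn R j * ξ := by
    linear_combination (sgn R j * ξ) * sgn_mul_self (R := R) i
  rw [SymplecticGroup.mem_iff, shortMatrix]
  simp only [Matrix.transpose_add, Matrix.transpose_sub, Matrix.transpose_one,
    Matrix.transpose_single, add_mul, sub_mul, mul_add, mul_sub, one_mul, mul_one, single_mul_J,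
    J_mul_single, sgn_opp, opp_opp, Matrix.single_mul_single_of_ne _ _ _ _ h1,
    Matrix.single_mul_single_of_ne _ _ _ _ hij, Matrix.single_mul_single_of_ne _ _ _ _ (ne_opp i),
    Matrix.single_mul_single_of_ne _ _ _ _ (ne_opp j).symm, neg_mul, e1, neg_neg, single_neg']
  abel

theorem longMatrix_mem (i : Idx n) (α : R) :
    longMatrix i α ∈ Matrix.symplecticGroup (Fin n) R := by
  rw [SymplecticGroup.mem_iff, longMatrix]
  simp only [Matrix.transpose_add, Matrix.transpose_one,
    Matrix.transpose_single, add_mul, mul_add, one_mul, mul_one, single_mul_J,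
    J_mul_single, sgn_opp, opp_opp, Matrix.single_mul_single_of_ne _ _ _ _ (ne_opp i),
    neg_mul, neg_neg, single_neg']
  abel

/-- The elementary short symplectic transvection `T_{ij}(ξ)`, where `i ≠ ±j`. -/
def shortT (i j : Idx n) (hij : i ≠ j) (_hij' : i ≠ opp j) (ξ : R) : Sp n R :=
  ⟨shortMatrix i j ξ, shortMatrix_mem i j hij ξ⟩

/-- The elementary long symplectic transvection `T_{i,-i}(α)`. -/
def longT (i : Idx n) (α : R) : Sp n R :=
  ⟨longMatrix i α, longMatrix_mem i α⟩

/-- The length `S_{i,-i}(g) = ∑_{j > 0} g_{ij} g'_{j,-i}` of the `i`-th row of `g`, where `g'` denotes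
the inverse of `g`. -/
def rowLength (g : Sp n R) (i : Idx n) : R :=
  ∑ j : Fin n, (g : Matrix (Idx n) (Idx n) R) i (Sum.inl j) *
    ((g⁻¹ : Sp n R) : Matrix (Idx n) (Idx n) R) (Sum.inl j) (opp i)

end Transvections

section Relations

variable {n : ℕ}

/-- An equivalence relation on the indices is unitary if `i ∼ j` implies `-i ∼ -j`. -/
def IsUnitary (ν : Setoid (Idx n)) : Prop :=
  ∀ i j, ν i j → ν (opp i) (opp j)

/-- A set of indices is self-conjugate if it is stable under `i ↦ -i`. -/
def IsSelfConj (C : Set (Idx n)) : Prop := ∀ i ∈ C, opp i ∈ C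

/-- `h(ν)`: the minimum size of the self-conjugate classes and the minimum size of the
non-self-conjugate classes, a minimum over the empty family being `∞`. -/
noncomputable def height (ν : Setoid (Idx n)) : ℕ∞ × ℕ∞ :=
  (⨅ C ∈ {C ∈ ν.classes | IsSelfConj C}, C.encard,
   ⨅ C ∈ {C ∈ ν.classes | ¬ IsSelfConj C}, C.encard)

end Relations

/-- A unitary form `D`-net of ideals of rank `2n` over `A`. -/
structure FormNet (n : ℕ) (A : Type*) [CommRing A] where
  /-- the net of ideals `σ_{ij}` -/
  σ : Idx n → Idx n → Ideal A
  /-- the column of form parameters `Γ_i` -/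
  Γ : Idx n → AddSubgroup A
  mul_le : ∀ i j k, σ i k * σ k j ≤ σ i j
  unitary : ∀ i j, σ i j = σ (opp j) (opp i)
  diag : ∀ i, σ i i = ⊤
  two_mul_mem : ∀ i, ∀ α ∈ σ i (opp i), 2 * α ∈ Γ i
  mem_of_mem : ∀ i, ∀ α ∈ Γ i, α ∈ σ i (opp i)
  sq_mul_mem : ∀ i j, ∀ ξ ∈ σ i j, ∀ α ∈ Γ j, ξ ^ 2 * α ∈ Γ i

namespace FormNet

variable {n : ℕ} {A : Type*} [CommRing A]

/-- Exactness: `σ_{i,-i} = ∑_{k ≠ ±i} σ_{ik} σ_{k,-i} + ⟨Γ_i⟩` for all `i`. -/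
def IsExact (F : FormNet n A) : Prop :=
  ∀ i, F.σ i (opp i) =
    (⨆ k ∈ {k : Idx n | k ≠ i ∧ k ≠ opp i}, F.σ i k * F.σ k (opp i)) ⊔ Ideal.span (F.Γ i : Set A)

instance : LE (FormNet n A) :=
  ⟨fun F F' => (∀ i j, F.σ i j ≤ F'.σ i j) ∧ ∀ i, F.Γ i ≤ F'.Γ i⟩

open Classical in
/-- The form net `[ν]_A` defined by a unitary equivalence relation `ν`. -/
noncomputable def ofRel (A : Type*) [CommRing A] (ν : Setoid (Idx n)) (hν : IsUnitary ν) :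
    FormNet n A where
  σ i j := if ν i j then ⊤ else ⊥
  Γ i := if ν i (opp i) then ⊤ else ⊥
  mul_le i j k := by
    by_cases h1 : ν i k
    · by_cases h2 : ν k j
      · simp [ν.trans' h1 h2]
      · simp [h2]
    · simp [h1]
  unitary i j := by
    have : ν i j ↔ ν (opp j) (opp i) := by
      constructor
      · intro h; exact ν.symm' (hν _ _ h)
      · intro h
        have := ν.symm' (hν _ _ h)
        rwa [opp_opp, opp_opp] at this
    simp only [this]
  diag i := by simp
  two_mul_mem i α hα := by
    by_cases h : ν i (opp i)
    · simp [h]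
    · simp only [h, if_false, Ideal.mem_bot] at hα
      simp [hα]
  mem_of_mem i α hα := by
    by_cases h : ν i (opp i)
    · simp [h]
    · simp only [h, if_false, AddSubgroup.mem_bot] at hα
      simp [hα]
  sq_mul_mem i j ξ hξ α hα := by
    by_cases h : ν i j
    · by_cases h2 : ν j (opp j)
      · have h3 : ν i (opp i) := ν.trans' h (ν.trans' h2 (ν.symm' (hν _ _ h)))
        simp [h3]
      · simp only [h2, if_false, AddSubgroup.mem_bot] at hα
        simp [hα, zero_mem]
    · simp only [h, if_false, Ideal.mem_bot] at hξ
      simp [hξ, zero_mem]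

/-- A form net is major with respect to `ν` if `[ν]_A ≤ (σ, Γ)`. -/
def IsMajor (F : FormNet n A) (ν : Setoid (Idx n)) (hν : IsUnitary ν) : Prop :=
  ofRel A ν hν ≤ F

/-- The form net subgroup `Sp(σ, Γ)`, as a subset of `Sp(2n, A)`. -/
def netSubgroup (F : FormNet n A) : Set (Sp n A) :=
  {g | (∀ i j, (g : Matrix (Idx n) (Idx n) A) i j ∈ F.σ i j) ∧ ∀ i, rowLength g i ∈ F.Γ i}

end FormNet

section StandardSetting

variable {R : Type*} [CommRing R] {n : ℕ}

/-- `(R, R', S)` is a standard setting: `S ⊆ R' ∩ R^*`, and every `ξ ∈ R` has a multiple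
`x ξ ∈ R'` with `x ∈ S`. -/
def IsStandardSetting (R' : Subring R) (S : Set R) : Prop :=
  (∀ x ∈ S, x ∈ R' ∧ IsUnit x) ∧ ∀ ξ : R, ∃ x ∈ S, x * ξ ∈ R'

/-- Any two elements of `S` have a common multiple in `S` with cofactor in `R'`. -/
theorem IsStandardSetting.exists_mul {R' : Subring R} {S : Set R} (hS : IsStandardSetting R' S)
    {x y : R} (hx : x ∈ S) (hy : y ∈ S) : ∃ z ∈ S, ∃ t : R', z = t * (x * y) := by
  obtain ⟨u, hu⟩ := (hS.1 x hx).2.mul (hS.1 y hy).2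
  obtain ⟨z, hz, hzt⟩ := hS.2 ((u⁻¹ : Rˣ) : R)
  exact ⟨z, hz, ⟨_, hzt⟩, by rw [← hu]; simp⟩

namespace FormNet

variable {R' : Subring R} {S : Set R}

/-- The ideal `{ξ ∈ R | ∃ x ∈ S, x ξ ∈ I}` for an ideal `I` of `R'`. -/
def closureIdeal (hS : IsStandardSetting R' S) (I : Ideal R') : Ideal R where
  carrier := {ξ | ∃ x ∈ S, ∃ η ∈ I, x * ξ = (η : R)}
  zero_mem' := by
    obtain ⟨x, hx, -⟩ := hS.2 0
    exact ⟨x, hx, 0, I.zero_mem, by simp⟩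
  add_mem' := by
    rintro a b ⟨x, hx, η, hη, h1⟩ ⟨y, hy, θ, hθ, h2⟩
    obtain ⟨z, hz, t, rfl⟩ := hS.exists_mul hx hy
    refine ⟨_, hz, t * ⟨y, (hS.1 y hy).1⟩ * η + t * ⟨x, (hS.1 x hx).1⟩ * θ,
      I.add_mem (I.mul_mem_left _ hη) (I.mul_mem_left _ hθ), ?_⟩
    push_cast
    rw [← h1, ← h2]
    ring
  smul_mem' := by
    rintro c a ⟨x, hx, η, hη, h1⟩
    obtain ⟨y, hy, h2⟩ := hS.2 c
    obtain ⟨z, hz, t, rfl⟩ := hS.exists_mul hx hy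
    refine ⟨_, hz, t * ⟨y * c, h2⟩ * η, I.mul_mem_left _ hη, ?_⟩
    push_cast
    rw [← h1, smul_eq_mul]
    ring

/-- The additive group `{α ∈ R | ∃ x ∈ S, x² α ∈ G}` for an additive subgroup `G` of `R'` which is
stable under multiplication by squares. -/
def closureAddSubgroup (hS : IsStandardSetting R' S) (G : AddSubgroup R')
    (hG : ∀ r : R', ∀ α ∈ G, r ^ 2 * α ∈ G) : AddSubgroup R where
  carrier := {α | ∃ x ∈ S, ∃ β ∈ G, x ^ 2 * α = (β : R)}
  zero_mem' := by
    obtain ⟨x, hx, -⟩ := hS.2 0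
    exact ⟨x, hx, 0, G.zero_mem, by simp⟩
  add_mem' := by
    rintro a b ⟨x, hx, η, hη, h1⟩ ⟨y, hy, θ, hθ, h2⟩
    obtain ⟨z, hz, t, rfl⟩ := hS.exists_mul hx hy
    refine ⟨_, hz, (t * ⟨y, (hS.1 y hy).1⟩) ^ 2 * η + (t * ⟨x, (hS.1 x hx).1⟩) ^ 2 * θ,
      G.add_mem (hG _ _ hη) (hG _ _ hθ), ?_⟩
    push_cast
    rw [← h1, ← h2]
    ring
  neg_mem' := by
    rintro a ⟨x, hx, η, hη, h1⟩
    exact ⟨x, hx, -η, G.neg_mem hη, by push_cast; rw [← h1]; ring⟩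

theorem sq_mul_mem_self (F : FormNet n R') (i : Idx n) (r : R') (α : R') (hα : α ∈ F.Γ i) :
    r ^ 2 * α ∈ F.Γ i :=
  F.sq_mul_mem i i r (by rw [F.diag]; trivial) α hα

/-- The `S`-closure in `R` of a form net over `R'`:
`σ_{ij} = {ξ ∈ R | ∃ x ∈ S, x ξ ∈ σ'_{ij}}` and `Γ_i = {α ∈ R | ∃ x ∈ S, x² α ∈ Γ'_i}`. -/
def sClosure (hS : IsStandardSetting R' S) (F : FormNet n R') : FormNet n R where
  σ i j := closureIdeal hS (F.σ i j)
  Γ i := closureAddSubgroup hS (F.Γ i) (F.sq_mul_mem_self i)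
  mul_le i j k := by
    rw [Ideal.mul_le]
    rintro a ⟨x, hx, η, hη, h1⟩ b ⟨y, hy, θ, hθ, h2⟩
    obtain ⟨z, hz, t, rfl⟩ := hS.exists_mul hx hy
    refine ⟨_, hz, t * (η * θ),
      Ideal.mul_mem_left _ _ (F.mul_le i j k (Ideal.mul_mem_mul hη hθ)), ?_⟩
    push_cast
    rw [← h1, ← h2]
    ring
  unitary i j := by rw [F.unitary i j]
  diag i := by
    rw [Ideal.eq_top_iff_one]
    obtain ⟨x, hx, h⟩ := hS.2 1
    exact ⟨x, hx, ⟨_, h⟩, by rw [F.diag]; trivial, rfl⟩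
  two_mul_mem i := by
    rintro a ⟨x, hx, η, hη, h1⟩
    refine ⟨x, hx, 2 * (⟨x, (hS.1 x hx).1⟩ * η), F.two_mul_mem i _ (Ideal.mul_mem_left _ _ hη), ?_⟩
    have h2 : ((2 : R') : R) = 2 := rfl
    push_cast
    rw [← h1, h2]
    ring
  mem_of_mem i := by
    rintro a ⟨x, hx, η, hη, h1⟩
    obtain ⟨z, hz, t, rfl⟩ := hS.exists_mul hx hx
    refine ⟨_, hz, t * η, Ideal.mul_mem_left _ _ (F.mem_of_mem i _ hη), ?_⟩
    push_cast
    rw [← h1]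
    ring
  sq_mul_mem i j := by
    rintro a ⟨x, hx, η, hη, h1⟩ b ⟨y, hy, θ, hθ, h2⟩
    obtain ⟨z, hz, t, rfl⟩ := hS.exists_mul hx hy
    refine ⟨_, hz, (t * η) ^ 2 * θ, F.sq_mul_mem i j _ (Ideal.mul_mem_left _ _ hη) _ hθ, ?_⟩
    push_cast
    rw [← h1, ← h2]
    ring

/-- The short and long `(σ', Γ')`-elementary transvections, as elements of `Sp(2n, R)`. -/
inductive IsElementary (F : FormNet n R') : Sp n R → Prop
  | short (s r : Idx n) (h : s ≠ r) (h' : s ≠ opp r) (ξ : R') (hξ : ξ ∈ F.σ s r) :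
      IsElementary F (shortT s r h h' (ξ : R))
  | long (s : Idx n) (α : R') (hα : α ∈ F.Γ s) : IsElementary F (longT s (α : R))

/-- The elementary form net subgroup `Ep(σ', Γ')`, as a subgroup of `Sp(2n, R)`. -/
def elementarySubgroup (F : FormNet n R') : Subgroup (Sp n R) :=
  Subgroup.closure {g | F.IsElementary g}

/-- The form net `(σ', Γ')` over `R'` is `S`-associated with `H ≤ Sp(2n, R)`. -/
structure IsAssociated (F : FormNet n R') (S : Set R) (H : Subgroup (Sp n R)) : Prop where
  elementary_le : F.elementarySubgroup ≤ H
  short_mem : ∀ (s r : Idx n) (h : s ≠ r) (h' : s ≠ opp r) (ξ : R), shortT s r h h' ξ ∈ H →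
    ∃ x ∈ S, ∃ η ∈ F.σ s r, x * ξ = (η : R)
  long_mem : ∀ (s : Idx n) (α : R), longT s α ∈ H →
    ∃ x ∈ S, ∃ β ∈ F.Γ s, x ^ 2 * α = (β : R)

end FormNet

end StandardSetting

/-- The transporter `{a ∈ G | a τ a⁻¹ ∈ X for all τ ∈ K}` from a subgroup `K` to a subset `X`. -/
def transporter {G : Type*} [Group G] (K : Subgroup G) (X : Set G) : Set G :=
  {a | ∀ τ ∈ K, a * τ * a⁻¹ ∈ X}

end SpNet

/-! Write B for the symplectic form. Short and long transvections all have the form v ↦ v + B(y,v)x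
+ B(x,v)y + αB(x,v)x with B(x,y) = 0 (`IsTrans`), and conjugation by a merely replaces x, y by ax,
ay. Short ones have α = 0. A conjugate of a long elementary transvection is a product of three
conjugates, by elements of H, of short ones (`conj_longT_mem_netSubgroup`), and Sp(σ,Γ) is closed
under products (`mul_mem_netSubgroup`). So it suffices that every b ∈ H of the form v ↦ v + B(q,v)p
+ B(p,v)q with B(p,q) = 0 lies in Sp(σ,Γ) (`mem_netSubgroup`). This is a condition on the columns of
b and b⁻¹: the coordinates of be_i lie in σ_{l,i}, and its half form ∑_{j>0} v_j v_{-j} lies in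
Γ_{-i}.

The tool is `Rel`: H contains a transvection up to denominators. It is R-bilinear enough to be cut
down by commutators (`Rel.comm`, `Rel.comm_rel`). Once only basis vectors are left, S-association
turns it into a statement about the net (`mem_sigma_of_rel`, `mem_gamma_of_rel`).

Locality enters because b - e has rank at most 2: modulo the maximal ideal, b fixes every vector
orthogonal to p and q. A non-self-conjugate class has at least five elements, which leaves room for
such vectors under a few more linear conditions (`exists_form_eq_zero_notMem`). On such a class d, H
contains up to denominators all transvections of orthogonal pairs (y,z) supported on d and -d with y
unimodular (`rel_of_supp`). Conjugating by b gives pairs P = by, Q = bz. From these `form_mem_sigma`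
bounds the coordinates of P on the class -d, and `exists_rel_vec` produces a sparse vector e_{-k} -
c e_{-i} - δ e_j whose transvection with P is in H up to denominators. Sparseness allows the other
coordinates of P and its half form to be read off (`Triple.mem_sigma`, `Triple.halfForm_mem_gamma`).
Degenerate y are handled by adding a generic vector.

On a self-conjugate class Γ_i is everything and only the coordinates matter; they come from
conjugates of long transvections with unit coefficient (`mem_sigma_of_self`). -/

namespace SpNet

/-! ### The symplectic form and the transvections attached to two orthogonal vectors -/

section Form

variable {R : Type*} [CommRing R] {n : ℕ}

/-- The standard symplectic form `B(v, w) = ∑ ε_i v_i w_{-i}`. -/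
def form : (Idx n → R) →ₗ[R] (Idx n → R) →ₗ[R] R :=
  LinearMap.mk₂ R (fun v w => ∑ i, sgn R i * v i * w (opp i))
    (fun v v' w => by simp [mul_add, add_mul, Finset.sum_add_distrib])
    (fun c v w => by
      simp only [Pi.smul_apply, smul_eq_mul, Finset.mul_sum]
      exact Finset.sum_congr rfl fun i _ => by ring)
    (fun v w w' => by simp [mul_add, Finset.sum_add_distrib])
    (fun c v w => by
      simp only [Pi.smul_apply, smul_eq_mul, Finset.mul_sum]
      exact Finset.sum_congr rfl fun i _ => by ring)

theorem form_apply (v w : Idx n → R) : form v w = ∑ i, sgn R i * v i * w (opp i) := rfl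

/-- The `i`-th standard basis vector. -/
def ve (i : Idx n) : Idx n → R := Pi.single i 1

theorem ve_apply (i j : Idx n) : (ve i : Idx n → R) j = if j = i then 1 else 0 := by
  simp [ve, Pi.single_apply]

@[simp] theorem ve_self (i : Idx n) : (ve i : Idx n → R) i = 1 := by simp [ve]

theorem ve_of_ne {i j : Idx n} (h : j ≠ i) : (ve i : Idx n → R) j = 0 := by simp [ve, h]

theorem sum_smul_ve (v : Idx n → R) : ∑ i, v i • ve i = v := by
  ext j
  simp [ve, Finset.sum_apply, Pi.single_apply]

@[simp] theorem form_ve_left (i : Idx n) (w : Idx n → R) :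
    form (ve i) w = sgn R i * w (opp i) := by
  rw [form_apply, Finset.sum_eq_single i]
  · simp
  · intro j _ h; simp [ve_of_ne h]
  · simp

theorem form_swap (v w : Idx n → R) : form w v = - form v w := by
  rw [form_apply, form_apply, ← Finset.sum_neg_distrib]
  refine Finset.sum_equiv (Equiv.sumComm _ _) (by simp) fun i _ => ?_
  cases i <;> simp [sgn, mul_comm]

@[simp] theorem form_self (v : Idx n → R) : form v v = 0 := by
  rw [form_apply, Fintype.sum_sum_type]
  simp [sgn, mul_comm]

@[simp] theorem form_ve_right (v : Idx n → R) (i : Idx n) :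
    form v (ve i) = - (sgn R i * v (opp i)) := by
  rw [form_swap, form_ve_left]

theorem form_eq_zero_swap {v w : Idx n → R} (h : form v w = 0) : form w v = 0 := by
  rw [form_swap, h, neg_zero]

theorem isUnit_sgn (i : Idx n) : IsUnit (sgn R i) :=
  IsUnit.of_mul_eq_one _ (sgn_mul_self i)

theorem form_eq_neg_J (v w : Idx n → R) :
    form v w = - (v ⬝ᵥ (Matrix.J (Fin n) R).mulVec w) := by
  rw [form_apply, dotProduct, ← Finset.sum_neg_distrib]
  refine Finset.sum_congr rfl fun i _ => ?_
  rw [Matrix.mulVec, dotProduct, Finset.sum_eq_single (opp i)]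
  · rw [J_apply]; simp; ring
  · intro j _ h; rw [J_apply]; simp [h]
  · simp

/-- The natural action of the symplectic group on column vectors. -/
def act (h : Sp n R) : (Idx n → R) →ₗ[R] (Idx n → R) :=
  Matrix.mulVecLin (h : Matrix (Idx n) (Idx n) R)

theorem act_one (v : Idx n → R) : act (1 : Sp n R) v = v := by simp [act]

theorem act_mul (g h : Sp n R) (v : Idx n → R) : act (g * h) v = act g (act h v) := by
  simp [act, Matrix.mulVec_mulVec]

@[simp] theorem act_inv_act (g : Sp n R) (v : Idx n → R) : act g⁻¹ (act g v) = v := by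
  rw [← act_mul, inv_mul_cancel, act_one]

@[simp] theorem act_act_inv (g : Sp n R) (v : Idx n → R) : act g (act g⁻¹ v) = v := by
  rw [← act_mul, mul_inv_cancel, act_one]

theorem act_ve (g : Sp n R) (i j : Idx n) :
    act g (ve j) i = (g : Matrix (Idx n) (Idx n) R) i j := by
  simp [act, ve]

@[simp] theorem form_act (g : Sp n R) (v w : Idx n → R) : form (act g v) (act g w) = form v w := by
  have hg := SymplecticGroup.mem_iff'.1 g.2
  rw [form_eq_neg_J, form_eq_neg_J]
  nth_rewrite 2 [← hg]
  simp only [act, Matrix.mulVecLin_apply]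
  rw [← Matrix.mulVec_mulVec, ← Matrix.mulVec_mulVec, Matrix.dotProduct_mulVec v,
    Matrix.vecMul_transpose]

theorem form_act_left (g : Sp n R) (v w : Idx n → R) :
    form (act g v) w = form v (act g⁻¹ w) := by
  rw [← form_act g v (act g⁻¹ w), act_act_inv]

/-- `h` is the transformation `v ↦ v + B(y,v) x + B(x,v) y + α B(x,v) x`. -/
def IsTrans (h : Sp n R) (x y : Idx n → R) (α : R) : Prop :=
  ∀ v, act h v = v + form y v • x + form x v • y + (α * form x v) • x

theorem act_injective : Function.Injective (act : Sp n R → _) := by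
  intro g h hgh
  apply Subtype.ext
  ext i j
  rw [← act_ve, ← act_ve, hgh]

namespace IsTrans

variable {g h h' : Sp n R} {x y y' : Idx n → R} {α α' : R}

theorem mul (hxy : form x y = 0) (hxy' : form x y' = 0) (H : IsTrans h x y α)
    (H' : IsTrans h' x y' α') : IsTrans (h * h') x (y + y') (α + α' + form y y') := by
  intro v
  have hyx := form_eq_zero_swap hxy
  rw [act_mul, H', H]
  simp only [map_add, map_smul, LinearMap.add_apply, hxy', hyx, form_self, smul_eq_mul]
  module

theorem inv (hxy : form x y = 0) (H : IsTrans h x y α) : IsTrans h⁻¹ x (-y) (-α) := by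
  intro v
  have : act h (v + form (-y) v • x + form x v • (-y) + (-α * form x v) • x) = v := by
    rw [H]
    simp only [map_add, map_smul, map_neg, LinearMap.neg_apply, hxy, form_eq_zero_swap hxy,
      form_self, smul_eq_mul]
    module
  rw [← act_inv_act h (v + _ + _ + _), this]

theorem conj (g : Sp n R) (H : IsTrans h x y α) :
    IsTrans (g * h * g⁻¹) (act g x) (act g y) α := by
  intro v
  rw [act_mul, act_mul, H]
  simp only [map_add, map_smul, act_act_inv, form_act_left]

theorem symm (H : IsTrans h x y 0) : IsTrans h y x 0 := by
  intro v
  rw [H]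
  module

theorem smul_left {c : R} : IsTrans h (c • x) y α ↔ IsTrans h x (c • y) (c ^ 2 * α) := by
  refine forall_congr' fun v => ?_
  rw [show v + form y v • c • x + form (c • x) v • y + (α * form (c • x) v) • c • x =
    v + form (c • y) v • x + form x v • c • y + (c ^ 2 * α * form x v) • x by
      simp only [map_smul, LinearMap.smul_apply, smul_eq_mul]; module]

theorem add_smul {c : R} : IsTrans h x (y + c • x) α ↔ IsTrans h x y (α + 2 * c) := by
  refine forall_congr' fun v => ?_
  rw [show v + form (y + c • x) v • x + form x v • (y + c • x) + (α * form x v) • x =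
    v + form y v • x + form x v • y + ((α + 2 * c) * form x v) • x by
      simp only [map_add, map_smul, LinearMap.add_apply, LinearMap.smul_apply, smul_eq_mul]; module]

theorem unique (H : IsTrans h x y α) (H' : IsTrans h' x y α) : h = h' := by
  apply act_injective
  ext1 i
  ext1
  simp [H _, H' _]

end IsTrans

theorem isTrans_shortT (i j : Idx n) (h : i ≠ j) (h' : i ≠ opp j) (ξ : R) :
    IsTrans (shortT i j h h' ξ) ((-(sgn R j) * ξ) • ve i) (ve (opp j)) 0 := by
  intro v
  have hj := sgn_mul_self (R := R) j
  have key : act (shortT i j h h' ξ) v = v + (ξ * v j) • ve i -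
      (sgn R i * sgn R j * ξ * v (opp i)) • ve (opp j) := by
    ext k
    simp [act, shortT, shortMatrix, Matrix.single_mulVec,
      ve, Pi.single_apply, Function.update_apply]
  have e : ξ * v j = -sgn R j * v j * (-sgn R j * ξ) := by linear_combination (-ξ * v j) * hj
  rw [key, e]
  simp only [form_ve_left, map_smul, LinearMap.smul_apply, smul_eq_mul, sgn_opp, opp_opp]
  module

theorem isTrans_longT (i : Idx n) (α : R) :
    IsTrans (longT i α) (ve i) 0 (sgn R i * α) := by
  intro v
  have hj := sgn_mul_self (R := R) i
  have key : act (longT i α) v = v + (α * v (opp i)) • ve i := by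
    ext k
    simp [act, longT, longMatrix, Matrix.single_mulVec,
      ve, Pi.single_apply, Function.update_apply]
  rw [key]
  simp only [form_ve_left, map_zero, LinearMap.zero_apply, zero_smul, smul_zero, add_zero]
  congr 2
  linear_combination (-α * v (opp i)) * hj

end Form

end SpNet

/-! ### Data of the theorem, and transvections of the overgroup up to denominators -/

namespace SpNet

theorem exists_mem_class_notMem {n : ℕ} {ν : Setoid (Idx n)} {k : ℕ} (d : Idx n)
    (h : (k : ℕ∞) ≤ {x | ν x d}.encard) (s : Finset (Idx n)) (hs : s.card < k) :
    ∃ j, ν d j ∧ j ∉ s := by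
  by_contra! hc
  have h1 : {x | ν x d} ⊆ (s : Set (Idx n)) := fun x hx => hc x (ν.symm' hx)
  have h2 := h.trans (Set.encard_le_encard h1)
  rw [Set.encard_coe_eq_coe_finsetCard] at h2
  have : k ≤ s.card := by exact_mod_cast h2
  omega

/-- The data of the main theorem. -/
structure Setting (n : ℕ) (R : Type*) [CommRing R] where
  /-- the subring `R'` -/
  R' : Subring R
  /-- the set of denominators -/
  S : Set R
  hS : IsStandardSetting R' S
  /-- the unitary equivalence relation -/
  ν : Setoid (Idx n)
  hν : IsUnitary ν
  le_height : ((4, 5) : ℕ∞ × ℕ∞) ≤ height ν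
  /-- the overgroup -/
  H : Subgroup (Sp n R)
  /-- the form net over `R'` -/
  F : FormNet n R'
  major : F.IsMajor ν hν
  assoc : F.IsAssociated S H

namespace Setting

variable {n : ℕ} {R : Type*} [CommRing R] (A : Setting n R)

/-- The `S`-closure of the form net. -/
def net : FormNet n R := A.F.sClosure A.hS

variable {A} in
theorem rel_opp {i j : Idx n} (h : A.ν i j) : A.ν (opp i) (opp j) := A.hν _ _ h

theorem exists_rel_of_self {d : Idx n} (hd : A.ν d (opp d)) :
    ∃ j, A.ν d j ∧ j ≠ d ∧ j ≠ opp d := by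
  have h := (Prod.mk_le_mk.1 A.le_height).1
  rw [le_iInf₂_iff] at h
  have := h {x | A.ν x d} ⟨Setoid.mem_classes _ _, fun i hi =>
    A.ν.trans' (rel_opp hi) (A.ν.symm' hd)⟩
  obtain ⟨j, hj, hj'⟩ := exists_mem_class_notMem (k := 4) d this {d, opp d}
    (Finset.card_le_two.trans_lt (by norm_num))
  simp only [Finset.mem_insert, Finset.mem_singleton, not_or] at hj'
  exact ⟨j, hj, hj'⟩

theorem le_encard_class {d : Idx n} (hd : ¬ A.ν d (opp d)) :
    (5 : ℕ∞) ≤ {x | A.ν x d}.encard := by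
  have h := (Prod.mk_le_mk.1 A.le_height).2
  rw [le_iInf₂_iff] at h
  exact h {x | A.ν x d} ⟨Setoid.mem_classes _ _, fun hs =>
    hd (A.ν.symm' (hs d (A.ν.refl' d)))⟩

theorem exists_rel_of_not_self {d : Idx n} (hd : ¬ A.ν d (opp d)) (s : Finset (Idx n))
    (hs : s.card < 5) : ∃ j, A.ν d j ∧ j ∉ s :=
  exists_mem_class_notMem d (A.le_encard_class hd) s hs

theorem not_self_opp {d : Idx n} (hd : ¬ A.ν d (opp d)) : ¬ A.ν (opp d) (opp (opp d)) :=
  fun h => hd (by rw [opp_opp] at h; exact A.ν.symm' h)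

theorem sigma_F_eq_top {i j : Idx n} (h : A.ν i j) : A.F.σ i j = ⊤ := by
  have := A.major.1 i j
  simpa [FormNet.ofRel, h] using this

theorem gamma_F_eq_top {i : Idx n} (h : A.ν i (opp i)) : A.F.Γ i = ⊤ := by
  have := A.major.2 i
  simpa [FormNet.ofRel, h] using this

theorem sigma_eq_top {i j : Idx n} (h : A.ν i j) : A.net.σ i j = ⊤ := by
  rw [Ideal.eq_top_iff_one]
  obtain ⟨x, hx, h1⟩ := A.hS.2 1
  exact ⟨x, hx, ⟨_, h1⟩, by rw [A.sigma_F_eq_top h]; trivial, rfl⟩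

theorem gamma_eq_top {i : Idx n} (h : A.ν i (opp i)) : A.net.Γ i = ⊤ := by
  rw [AddSubgroup.eq_top_iff']
  intro α
  obtain ⟨x, hx, h1⟩ := A.hS.2 α
  refine ⟨x, hx, ⟨x, (A.hS.1 x hx).1⟩ * ⟨_, h1⟩, by rw [A.gamma_F_eq_top h]; trivial, ?_⟩
  push_cast
  ring

theorem sigma_le_of_rel {i i' j j' : Idx n} (h : A.ν i i') (h' : A.ν j j') :
    A.net.σ i j ≤ A.net.σ i' j' := by
  have h1 := A.net.mul_le i' j i
  rw [A.sigma_eq_top (A.ν.symm' h), Ideal.top_mul] at h1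
  have h2 := A.net.mul_le i' j' j
  rw [A.sigma_eq_top h', Ideal.mul_top] at h2
  exact h1.trans h2

theorem gamma_le_of_rel {i j : Idx n} (h : A.ν i j) : A.net.Γ i ≤ A.net.Γ j := by
  intro α hα
  have := A.net.sq_mul_mem j i 1 (by rw [A.sigma_eq_top (A.ν.symm' h)]; trivial) α hα
  simpa using this

theorem mul_mem_sigma {i j k : Idx n} {a b : R} (ha : a ∈ A.net.σ i k) (hb : b ∈ A.net.σ k j) :
    a * b ∈ A.net.σ i j := A.net.mul_le i j k (Ideal.mul_mem_mul ha hb)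

theorem mem_sigma_opp {i j : Idx n} {a : R} : a ∈ A.net.σ (opp i) (opp j) ↔ a ∈ A.net.σ j i := by
  rw [A.net.unitary j i]

theorem shortT_mem {s r : Idx n} (h : s ≠ r) (h' : s ≠ opp r) {ξ : A.R'} (hξ : ξ ∈ A.F.σ s r) :
    shortT s r h h' (ξ : R) ∈ A.H :=
  A.assoc.elementary_le (Subgroup.subset_closure (.short s r h h' ξ hξ))

theorem longT_mem {s : Idx n} {α : A.R'} (hα : α ∈ A.F.Γ s) : longT s (α : R) ∈ A.H :=
  A.assoc.elementary_le (Subgroup.subset_closure (.long s α hα))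

/-- Majority makes the coefficient 1 available, so commutators with this element move coordinates
within a class without multiplying them by non-units. -/
theorem exists_short {s r : Idx n} (h : s ≠ r) (h' : s ≠ opp r) (hsr : A.ν s r) :
    ∃ g ∈ A.H, ∀ v, act g v = v + v r • ve s - (sgn R s * sgn R r * v (opp s)) • ve (opp r) := by
  refine ⟨_, A.shortT_mem h h' (ξ := 1) (by rw [A.sigma_F_eq_top hsr]; trivial), fun v => ?_⟩
  have hr := sgn_mul_self (R := R) r
  have e : v r = -sgn R r * v r * (-sgn R r) := by linear_combination (-v r) * hr
  rw [e, isTrans_shortT _ _ _ _ _ v]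
  simp only [form_ve_left, map_smul, LinearMap.smul_apply, smul_eq_mul, sgn_opp, opp_opp,
    OneMemClass.coe_one]
  module

theorem exists_long {s : Idx n} (hs : A.ν s (opp s)) :
    ∃ g ∈ A.H, ∀ v, act g v = v + v (opp s) • ve s := by
  refine ⟨_, A.longT_mem (α := 1) (by rw [A.gamma_F_eq_top hs]; trivial), fun v => ?_⟩
  have hr := sgn_mul_self (R := R) s
  rw [isTrans_longT _ _ v]
  simp only [form_ve_left, map_zero, LinearMap.zero_apply, zero_smul, smul_zero, add_zero]
  congr 2
  push_cast
  linear_combination (v (opp s)) * hr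

/-- The overgroup contains the transvections `v ↦ v + B(y,v) x + B(x,v) y + α B(x,v) x` up to
denominators: after `x` is replaced by any `R'`-multiple of `λ x` for a suitable `λ ∈ S`. -/
def Rel (x y : Idx n → R) (α : R) : Prop :=
  form x y = 0 ∧ ∃ l ∈ A.S, ∀ r ∈ A.R', ∃ h ∈ A.H, IsTrans h ((r * l) • x) y α

variable {A} in
theorem Rel.exists_isTrans {x y : Idx n → R} {α : R} (h : A.Rel x y α) :
    ∃ l : R, IsUnit l ∧ ∃ h ∈ A.H, IsTrans h (l • x) y α := by
  obtain ⟨h0, l, hl, h⟩ := h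
  refine ⟨l, (A.hS.1 l hl).2, ?_⟩
  simpa using h 1 (one_mem _)

/-! ### Calculus of transvections up to denominators -/

namespace Rel

variable {A} {x x' y y' : Idx n → R} {α α' c : R}

/-- The two denominators are replaced by a common multiple in S; this is why `Rel` asks for all
R'-multiples of l x and not for a single one. -/
theorem add (h : A.Rel x y α) (h' : A.Rel x y' α') :
    A.Rel x (y + y') (α + α' + form y y') := by
  obtain ⟨h0, l, hl, h⟩ := h
  obtain ⟨h0', l', hl', h'⟩ := h'
  obtain ⟨z, hz, t, rfl⟩ := A.hS.exists_mul hl hl'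
  refine ⟨by rw [map_add, h0, h0', add_zero], _, hz, fun r hr => ?_⟩
  obtain ⟨g, hg, hg1⟩ := h (r * t * l') (mul_mem (mul_mem hr t.2) (A.hS.1 _ hl').1)
  obtain ⟨g', hg', hg1'⟩ := h' (r * t * l) (mul_mem (mul_mem hr t.2) (A.hS.1 _ hl).1)
  refine ⟨g * g', mul_mem hg hg', ?_⟩
  rw [show r * t * l' * l = r * (t * (l * l')) by ring] at hg1
  rw [show r * t * l * l' = r * (t * (l * l')) by ring] at hg1'
  exact hg1.mul (by simp [h0]) (by simp [h0']) hg1'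

theorem neg (h : A.Rel x y α) : A.Rel x (-y) (-α) := by
  obtain ⟨h0, l, hl, h⟩ := h
  refine ⟨by simp [h0], _, hl, fun r hr => ?_⟩
  obtain ⟨g, hg, hg1⟩ := h r hr
  exact ⟨g⁻¹, inv_mem hg, hg1.inv (by simp [h0])⟩

theorem add_zero_zero (h : A.Rel x y 0) (h' : A.Rel x y' 0) (hy : form y y' = 0) :
    A.Rel x (y + y') 0 := by
  simpa [hy] using h.add h'

/-- A further denominator brings c into R'. Together with `symm` this makes `Rel` with α = 0 stable
under arbitrary scalars of R on either side. -/
theorem smul_left (h : A.Rel x y α) (c : R) : A.Rel (c • x) y α := by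
  obtain ⟨h0, l, hl, h⟩ := h
  obtain ⟨m, hm, hmc⟩ := A.hS.2 c
  obtain ⟨z, hz, t, rfl⟩ := A.hS.exists_mul hl hm
  refine ⟨by simp [h0], _, hz, fun r hr => ?_⟩
  obtain ⟨g, hg, hg1⟩ := h (r * t * (m * c)) (mul_mem (mul_mem hr t.2) hmc)
  refine ⟨g, hg, ?_⟩
  rw [smul_smul]
  convert hg1 using 2
  ring

theorem symm (h : A.Rel x y 0) : A.Rel y x 0 := by
  obtain ⟨h0, l, hl, h⟩ := h
  refine ⟨form_eq_zero_swap h0, _, hl, fun r hr => ?_⟩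
  obtain ⟨g, hg, hg1⟩ := h r hr
  refine ⟨g, hg, IsTrans.smul_left.2 ?_⟩
  rw [mul_zero]
  exact hg1.symm

theorem smul_right (h : A.Rel x y 0) (c : R) : A.Rel x (c • y) 0 := (h.symm.smul_left c).symm

theorem conj (h : A.Rel x y α) {g : Sp n R} (hg : g ∈ A.H) : A.Rel (act g x) (act g y) α := by
  obtain ⟨h0, l, hl, h⟩ := h
  refine ⟨by simp [h0], _, hl, fun r hr => ?_⟩
  obtain ⟨k, hk, hk1⟩ := h r hr
  refine ⟨_, mul_mem (mul_mem hg hk) (inv_mem hg), ?_⟩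
  rw [← map_smul]
  exact hk1.conj g

/-- The commutator of g with a transvection attached to a vector x fixed by g is again attached to
x, so x is kept while y shrinks to gy - y. -/
theorem comm (h : A.Rel x y α) {g : Sp n R} (hg : g ∈ A.H) (hgx : act g x = x) :
    A.Rel x (act g y - y) (- form (act g y) y) := by
  have h1 := h.conj hg
  rw [hgx] at h1
  simpa [sub_eq_add_neg] using h1.add h.neg

theorem of_unit_smul_right (hc : IsUnit c) (h : A.Rel x (c • y) 0) : A.Rel x y 0 := by
  obtain ⟨u, rfl⟩ := hc
  simpa [smul_smul] using h.smul_right ((u⁻¹ : Rˣ) : R)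

/-- The transvection (v,v') fixes x and moves y by a multiple of v. Since that multiple is
orthogonal to y, the long part α disappears as well. -/
theorem comm_rel (h : A.Rel x y α) {v v' : Idx n → R} (hv : A.Rel v v' 0) (h1 : form v x = 0)
    (h2 : form v' x = 0) (h3 : form v y = 0) : A.Rel x (form v' y • v) 0 := by
  obtain ⟨l, hl, g, hg, hgt⟩ := hv.exists_isTrans
  have h4 := h.comm hg (by rw [hgt]; simp [h1, h2])
  have h5 : act g y - y = l • (form v' y • v) := by
    rw [hgt]; simp [h3, smul_smul, mul_comm]
  rw [h5, show act g y = (act g y - y) + y by abel, h5] at h4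
  refine of_unit_smul_right hl ?_
  simpa [h3] using h4

theorem short (h : A.Rel x y α) {s r : Idx n} (hsr : A.ν s r) (h1 : s ≠ r) (h2 : s ≠ opp r)
    (hr : x r = 0) (hs : x (opp s) = 0) :
    A.Rel x (y r • ve s - (sgn R s * sgn R r * y (opp s)) • ve (opp r))
      (- form (y r • ve s - (sgn R s * sgn R r * y (opp s)) • ve (opp r)) y) := by
  obtain ⟨g, hg, hgv⟩ := A.exists_short h1 h2 hsr
  have h4 := h.comm hg (by rw [hgv]; simp [hr, hs])
  have h5 : act g y - y = y r • ve s - (sgn R s * sgn R r * y (opp s)) • ve (opp r) := by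
    rw [hgv]; abel
  rw [show act g y = (act g y - y) + y by abel, h5] at h4
  simpa using h4

theorem short_single (h : A.Rel x y α) {s r : Idx n} (hsr : A.ν s r) (h1 : s ≠ r) (h2 : s ≠ opp r)
    (hr : x r = 0) (hs : x (opp s) = 0) (hy : y (opp s) = 0) :
    A.Rel x (y r • ve s) 0 := by
  simpa [hy] using h.short hsr h1 h2 hr hs

theorem long (h : A.Rel x y α) {s : Idx n} (hs : A.ν s (opp s)) (hx : x (opp s) = 0) :
    A.Rel x (y (opp s) • ve s) (- (sgn R s * y (opp s) ^ 2)) := by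
  obtain ⟨g, hg, hgv⟩ := A.exists_long hs
  have h4 := h.comm hg (by rw [hgv]; simp [hx])
  have h5 : act g y - y = y (opp s) • ve s := by
    rw [hgv]; abel
  rw [h5, show act g y = (act g y - y) + y by abel, h5] at h4
  convert h4 using 1
  simp
  ring

/-- Extraction of a coordinate of `y` outside of the support of `x`. -/
theorem extract (h : A.Rel x y α) {l : Idx n} (hx : ∀ i, A.ν l i → x i = 0)
    (hx' : ∀ i, A.ν (opp l) i → x i = 0) :
    ∃ m, A.ν l m ∧ A.Rel x (y l • ve m) 0 := by
  by_cases hl : A.ν l (opp l)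
  · obtain ⟨m, hm, hm1, hm2⟩ := A.exists_rel_of_self hl
    -- The long commutator isolates y_l on e_{-l} at the price of a long part; the short commutator
    -- that follows removes it.
    have h1 := h.long (s := opp l) (by rw [opp_opp]; exact A.ν.symm' hl)
      (by rw [opp_opp]; exact hx l (A.ν.refl' l))
    rw [opp_opp] at h1
    have h2 := h1.short_single (s := m) (r := opp l) (A.ν.trans' (A.ν.symm' hm) hl) hm2
      (by rwa [opp_opp]) (hx _ hl) (hx' _ (rel_opp hm))
      (by simp [ve_of_ne (fun h => hm1 ((opp_eq_iff _ _).1 h))])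
    exact ⟨m, hm, by simpa using h2⟩
  · obtain ⟨m, hm, hm1⟩ := A.exists_rel_of_not_self hl {l} (by simp)
    obtain ⟨k, hk, hk1⟩ := A.exists_rel_of_not_self hl {l, m}
      (Finset.card_le_two.trans_lt (by norm_num))
    simp only [Finset.mem_insert, Finset.mem_singleton, not_or] at hk1 hm1
    have e1 : ∀ i j, A.ν l i → A.ν l j → i ≠ opp j := fun i j hi hj hij =>
      hl (A.ν.trans' hi (by rw [hij]; exact rel_opp (A.ν.symm' hj)))
    have hll := A.ν.refl' l
    -- The first commutator leaves y_l on e_m, a stray term on e_{-l} and a long part. The second,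
    -- with k ≠ l, kills the last two.
    have h1 := h.short (s := m) (r := l) (A.ν.symm' hm) hm1 (e1 _ _ hm hll) (hx l hll)
      (hx' _ (rel_opp hm))
    have h2 := h1.short_single (s := k) (r := m) (A.ν.trans' (A.ν.symm' hk) hm) hk1.2
      (e1 _ _ hk hm) (hx m hm) (hx' _ (rel_opp hk)) (by
        rw [Pi.sub_apply, Pi.smul_apply, Pi.smul_apply, ve_of_ne (e1 _ _ hm hk).symm,
          ve_of_ne (fun h => hk1.1 ((opp_eq_iff _ _).1 h))]
        simp)
    refine ⟨k, hk, ?_⟩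
    simpa [ve_of_ne (e1 _ _ hm hll)] using h2

end Rel

theorem exists_coe_eq_sgn (i : Idx n) : ∃ s : A.R', (s : R) = sgn R i := by
  rcases i with i | i
  · exact ⟨1, by simp [sgn]⟩
  · exact ⟨-1, by simp [sgn]⟩

theorem rel_ve {i j : Idx n} {c : R} (hij : i ≠ j) (hc : c ∈ A.net.σ i j) :
    A.Rel (c • ve i) (ve (opp j)) 0 := by
  have hij' : opp j ≠ opp i := fun h => hij ((opp_eq_iff _ _).1 h).symm
  obtain ⟨x, hx, η, hη, hxc⟩ := hc
  have hj := sgn_mul_self (R := R) j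
  obtain ⟨s, hs⟩ := A.exists_coe_eq_sgn j
  refine ⟨by simp [ve_of_ne hij.symm], x, hx, fun r hr => ?_⟩
  -- In this case the transvection attached to (c e_i, e_i) is long with coefficient ±2c, and it is
  -- elementary up to denominators because 2σ'_{i,-i} ⊆ Γ'_i.
  by_cases hi : i = opp j
  · subst hi
    refine ⟨_, A.longT_mem (A.F.two_mul_mem (opp j) (-s * ⟨r, hr⟩ * η)
      (Ideal.mul_mem_left _ _ (by rwa [opp_opp]))), ?_⟩
    rw [smul_smul, IsTrans.smul_left, ← zero_add (_ • ve _), IsTrans.add_smul]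
    convert isTrans_longT (opp j) _ using 1
    have h2 : ((2 : A.R') : R) = 2 := rfl
    push_cast
    rw [← hxc, hs, sgn_opp, h2]
    linear_combination (-2 * r * x * c) * hj
  · have h1 := A.shortT_mem hij hi (Ideal.mul_mem_left _ (-s * ⟨r, hr⟩) hη)
    refine ⟨_, h1, ?_⟩
    convert isTrans_shortT i j hij hi _ using 1
    rw [smul_smul]
    congr 1
    push_cast
    rw [← hxc, hs]
    linear_combination (- r * x * c) * hj

theorem mem_sigma_of_rel {i j : Idx n} {c : R} (hij : i ≠ j) (hij' : i ≠ opp j)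
    (h : A.Rel (c • ve i) (ve (opp j)) 0) : c ∈ A.net.σ i j := by
  obtain ⟨l, hl, g, hg, hgt⟩ := h.exists_isTrans
  have hj := sgn_mul_self (R := R) j
  have h1 : g = shortT i j hij hij' (-(sgn R j) * (l * c)) := by
    refine hgt.unique (y := ve (opp j)) (α := 0) ?_
    convert isTrans_shortT i j hij hij' _ using 1
    rw [smul_smul]
    congr 1
    linear_combination (- l * c) * hj
  rw [h1] at hg
  have h2 : -(sgn R j) * (l * c) ∈ A.net.σ i j := A.assoc.short_mem i j hij hij' _ hg
  rw [← mul_assoc] at h2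
  exact (Ideal.unit_mul_mem_iff_mem _ ((isUnit_sgn j).neg.mul hl)).1 h2

theorem mem_gamma_of_rel {i : Idx n} {α : R} (h : A.Rel (ve i) 0 α) : α ∈ A.net.Γ i := by
  obtain ⟨l, hl, g, hg, hgt⟩ := h.exists_isTrans
  have hj := sgn_mul_self (R := R) i
  rw [IsTrans.smul_left, smul_zero] at hgt
  have h1 : g = longT i (sgn R i * (l ^ 2 * α)) := by
    refine hgt.unique (y := 0) (α := l ^ 2 * α) ?_
    convert isTrans_longT i _ using 1
    linear_combination (-l ^ 2 * α) * hj
  rw [h1] at hg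
  have h2 : sgn R i * (l ^ 2 * α) ∈ A.net.Γ i := A.assoc.long_mem i _ hg
  have h3 : l ^ 2 * α ∈ A.net.Γ i := by
    rcases i with i | i
    · simpa [sgn] using h2
    · simpa [sgn] using h2
  obtain ⟨u, rfl⟩ := hl
  have h4 := A.net.sq_mul_mem i i ((u⁻¹ : Rˣ) : R) (by rw [A.net.diag]; trivial) _ h3
  rwa [← mul_assoc, ← mul_pow, Units.inv_mul, one_pow, one_mul] at h4

end Setting

end SpNet

namespace SpNet

open IsLocalRing Module

/-! ### Linear systems over a local ring -/

section LocalLinearAlgebra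

variable {R : Type*} [CommRing R] [IsLocalRing R] {ι : Type*} [Fintype ι]

theorem residue_dotProduct (f x : ι → R) :
    residue R (f ⬝ᵥ x) = (fun i => residue R (f i)) ⬝ᵥ (fun i => residue R (x i)) := by
  simp [dotProduct]

theorem exists_rightInverse_of_linearIndependent {K : Type*} [Field K] {k : ℕ}
    (f : Fin k → ι → K) (hf : LinearIndependent K f) :
    ∃ G : Matrix ι (Fin k) K, Matrix.of f * G = 1 := by
  classical
  have hinj : Function.Injective (Matrix.vecMulLinear (Matrix.of f)) :=
    Matrix.vecMul_injective_iff.2 hf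
  obtain ⟨g, hg⟩ := LinearMap.exists_leftInverse_of_injective _ (LinearMap.ker_eq_bot.2 hinj)
  refine ⟨Matrix.of fun i b => g (Pi.single i 1) b, ?_⟩
  ext a b
  have h1 := congrFun (LinearMap.congr_fun hg (Pi.single a 1)) b
  rw [LinearMap.comp_apply, Matrix.vecMulLinear_apply, Matrix.single_one_vecMul,
    LinearMap.pi_apply_eq_sum_univ g] at h1
  simp only [LinearMap.id_apply, Finset.sum_apply, Pi.smul_apply, smul_eq_mul] at h1
  rw [Matrix.mul_apply, Matrix.one_apply]
  rw [Pi.single_apply] at h1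
  simp only [eq_comm (a := b)] at h1
  rw [← h1]
  refine Finset.sum_congr rfl fun i _ => ?_
  rw [Matrix.of_apply, Matrix.of_apply, Matrix.row_apply, Matrix.of_apply]
  congr 1
  refine congrFun (congrArg g (funext fun j => ?_)) b
  simp [Pi.single_apply, eq_comm]

/-- Over a local ring, a linear system whose rows are independent over the residue field can be
solved by a lift of any of its solutions over the residue field. -/
theorem exists_lift_solution {k : ℕ} (f : Fin k → ι → R)
    (hf : LinearIndependent (ResidueField R) fun a i => residue R (f a i)) (c : Fin k → R)
    (x₀ : ι → R) (h : ∀ a, residue R (f a ⬝ᵥ x₀) = residue R (c a)) :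
    ∃ x : ι → R, (∀ a, f a ⬝ᵥ x = c a) ∧ ∀ i, residue R (x i) = residue R (x₀ i) := by
  classical
  obtain ⟨G', hG'⟩ := exists_rightInverse_of_linearIndependent _ hf
  choose s hs using residue_surjective (R := R)
  set G : Matrix ι (Fin k) R := fun i a => s (G' i a)
  set F : Matrix (Fin k) ι R := Matrix.of f
  have h1 : (F * G).map (residue R) = 1 := by
    rw [Matrix.map_mul, ← hG']
    congr 1
    ext i a
    exact hs _
  have h2 : IsUnit (F * G).det := by
    rw [← residue_ne_zero_iff_isUnit, RingHom.map_det, RingHom.mapMatrix_apply, h1, Matrix.det_one]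
    exact one_ne_zero
  -- F G is invertible because its reduction is the identity. The correction G y makes the solution
  -- exact, and it vanishes modulo the maximal ideal because the defect of x₀ does.
  set y : Fin k → R := (F * G)⁻¹.mulVec (c - F.mulVec x₀)
  refine ⟨x₀ + G.mulVec y, fun a => ?_, fun i => ?_⟩
  · change (F.mulVec (x₀ + G.mulVec y)) a = c a
    rw [Matrix.mulVec_add, Matrix.mulVec_mulVec, Matrix.mulVec_mulVec,
      Matrix.mul_nonsing_inv _ h2, Matrix.one_mulVec]
    simp
  · have h3 : ∀ a, residue R ((c - F.mulVec x₀) a) = 0 := fun a => by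
      rw [Pi.sub_apply, map_sub, ← h a]
      exact sub_self _
    have h4 : ∀ a, residue R (y a) = 0 := fun a => by
      change residue R ((fun b => (F * G)⁻¹ a b) ⬝ᵥ (c - F.mulVec x₀)) = 0
      rw [residue_dotProduct]
      simp only [h3]
      exact dotProduct_zero _
    have h5 : residue R (G.mulVec y i) = 0 := by
      change residue R ((fun b => G i b) ⬝ᵥ y) = 0
      rw [residue_dotProduct]
      simp only [h4]
      exact dotProduct_zero _
    rw [Pi.add_apply, map_add, h5, add_zero]

theorem exists_solution {k : ℕ} (f : Fin k → ι → R)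
    (hf : LinearIndependent (ResidueField R) fun a i => residue R (f a i)) (c : Fin k → R) :
    ∃ x : ι → R, ∀ a, f a ⬝ᵥ x = c a := by
  classical
  obtain ⟨G', hG'⟩ := exists_rightInverse_of_linearIndependent _ hf
  choose s hs using residue_surjective (R := R)
  obtain ⟨x, hx, -⟩ := exists_lift_solution f hf c
    (fun i => s (G'.mulVec (fun a => residue R (c a)) i)) (fun a => by
      rw [residue_dotProduct]
      simp only [hs]
      change ((Matrix.of fun a i => residue R (f a i)).mulVec _) a = _
      rw [Matrix.mulVec_mulVec, hG', Matrix.one_mulVec])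
  exact ⟨x, hx⟩

/-- Over the residue field the common kernel of the k + l functionals has dimension greater than
that of W. A kernel vector outside W is lifted so as to solve the independent equations f exactly;
the equations g, not assumed independent, survive only modulo the maximal ideal. -/
theorem exists_solution_notMem {k l : ℕ} (f : Fin k → ι → R)
    (hf : LinearIndependent (ResidueField R) fun a i => residue R (f a i)) (g : Fin l → ι → R)
    (W : Submodule (ResidueField R) (ι → ResidueField R))
    (hW : finrank (ResidueField R) W + k + l < Fintype.card ι) :
    ∃ x : ι → R, (∀ a, f a ⬝ᵥ x = 0) ∧ (∀ b, residue R (g b ⬝ᵥ x) = 0) ∧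
      (fun i => residue R (x i)) ∉ W := by
  classical
  choose s hs using residue_surjective (R := R)
  set Φ : (ι → ResidueField R) →ₗ[ResidueField R]
      (Fin k → ResidueField R) × (Fin l → ResidueField R) :=
    (Matrix.mulVecLin (Matrix.of fun a i => residue R (f a i))).prod
      (Matrix.mulVecLin (Matrix.of fun a i => residue R (g a i)))
  have h1 := Φ.finrank_range_add_finrank_ker
  have h2 : finrank (ResidueField R) (LinearMap.range Φ) ≤ k + l := by
    refine (Submodule.finrank_le _).trans ?_
    simp
  rw [finrank_fintype_fun_eq_card] at h1
  have h3 : ¬ LinearMap.ker Φ ≤ W := fun hle => by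
    have := Submodule.finrank_mono hle
    omega
  obtain ⟨z, hz, hzW⟩ := SetLike.not_le_iff_exists.1 h3
  obtain ⟨hz1, hz2⟩ := Prod.mk.inj (LinearMap.mem_ker.1 hz)
  have e : ∀ v : ι → R, residue R (v ⬝ᵥ fun i => s (z i)) = (fun i => residue R (v i)) ⬝ᵥ z :=
    fun v => by rw [residue_dotProduct]; simp only [hs]
  obtain ⟨x, hx, hx'⟩ := exists_lift_solution f hf 0 (fun i => s (z i)) (fun a => by
    rw [e]
    rw [Pi.zero_apply, map_zero]
    exact congrFun hz1 a)
  have hxz : (fun i => residue R (x i)) = z := by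
    funext i; rw [hx', hs]
  refine ⟨x, hx, fun b => ?_, by rwa [hxz]⟩
  rw [residue_dotProduct, hxz]
  exact congrFun hz2 b

end LocalLinearAlgebra

/-! ### Vectors supported on one class and their reductions -/

namespace Setting

variable {n : ℕ} {R : Type*} [CommRing R] (A : Setting n R)

/-- `v` is supported on the class of `d`. -/
def Supp (d : Idx n) (v : Idx n → R) : Prop := ∀ i, ¬ A.ν d i → v i = 0

namespace Supp

variable {A} {d : Idx n} {v w : Idx n → R}

theorem add (hv : A.Supp d v) (hw : A.Supp d w) : A.Supp d (v + w) := fun i hi => by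
  simp [hv i hi, hw i hi]

theorem sub (hv : A.Supp d v) (hw : A.Supp d w) : A.Supp d (v - w) := fun i hi => by
  simp [hv i hi, hw i hi]

theorem smul (c : R) (hv : A.Supp d v) : A.Supp d (c • v) := fun i hi => by
  simp [hv i hi]

theorem ve {i : Idx n} (h : A.ν d i) : A.Supp d (SpNet.ve i : Idx n → R) := fun _ hj =>
  ve_of_ne fun hij => hj (hij ▸ h)

theorem form_eq_zero (hd : ¬ A.ν d (opp d)) (hv : A.Supp d v) (hw : A.Supp d w) :
    form v w = 0 := by
  rw [form_apply]
  refine Finset.sum_eq_zero fun i _ => ?_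
  by_cases hi : A.ν d i
  · rw [hw (opp i) fun h => hd (A.ν.trans' h (rel_opp (A.ν.symm' hi))), mul_zero]
  · rw [hv i hi, mul_zero, zero_mul]

theorem to_opp_opp (h : A.Supp d v) : A.Supp (opp (opp d)) v := by
  rwa [SpNet.opp_opp]

end Supp

open Classical in
/-- The vector supported on the class of `-d` that pairs with `v` to `∑ v_i u_i`. -/
noncomputable def spread (d : Idx n) (u : {i // A.ν d i} → R) : Idx n → R :=
  fun j => if h : A.ν d (opp j) then sgn R (opp j) * u ⟨opp j, h⟩ else 0

theorem supp_spread (d : Idx n) (u : {i // A.ν d i} → R) : A.Supp (opp d) (A.spread d u) := by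
  intro j hj
  rw [spread, dif_neg fun h => hj (by simpa [opp_opp] using A.hν _ _ h)]

open Classical in
theorem form_spread (d : Idx n) (u : {i // A.ν d i} → R) (v : Idx n → R) :
    form v (A.spread d u) = (fun i : {i // A.ν d i} => v i) ⬝ᵥ u := by
  have h : ∑ i, (if h : A.ν d i then v i * u ⟨i, h⟩ else 0) = (fun i : {i // A.ν d i} => v i) ⬝ᵥ u := by
    rw [Finset.sum_dite, Finset.sum_const_zero, add_zero, dotProduct]
    refine Finset.sum_bij' (fun i _ => ⟨i, (Finset.mem_filter.1 i.2).2⟩)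
      (fun i _ => ⟨i, Finset.mem_filter.2 ⟨Finset.mem_univ _, i.2⟩⟩) ?_ ?_ ?_ ?_ ?_ <;> simp
  rw [form_apply, ← h]
  refine Finset.sum_congr rfl fun i _ => ?_
  by_cases hi : A.ν d i
  · have hs := sgn_mul_self (R := R) i
    simp only [spread, opp_opp, hi, dite_true]
    linear_combination (v i * u ⟨i, hi⟩) * hs
  · simp [spread, hi]

variable [IsLocalRing R]

/-- The reduction modulo the maximal ideal of the part of `v` supported on the class of `d`. -/
noncomputable def pr (d : Idx n) (v : Idx n → R) : {i // A.ν d i} → ResidueField R :=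
  fun i => residue R (v i)

theorem pr_add (d : Idx n) (v w : Idx n → R) : A.pr d (v + w) = A.pr d v + A.pr d w := by
  ext; simp [pr]

theorem pr_smul (d : Idx n) (c : R) (v : Idx n → R) :
    A.pr d (c • v) = residue R c • A.pr d v := by
  ext; simp [pr]

theorem pr_of_supp {d e : Idx n} (h : ¬ A.ν d e) {v : Idx n → R} (hv : A.Supp e v) :
    A.pr d v = 0 := by
  ext i
  simp [pr, hv i fun hi => h (A.ν.trans' i.2 (A.ν.symm' hi))]

theorem exists_isUnit_of_pr_ne_zero {d : Idx n} {v : Idx n → R} (h : A.pr d v ≠ 0) :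
    ∃ i, A.ν d i ∧ IsUnit (v i) := by
  by_contra! hc
  refine h (funext fun i => ?_)
  by_contra h1
  exact hc i i.2 ((residue_ne_zero_iff_isUnit _).1 h1)

/-- The parts of the vectors `x a` supported on the class of `d` are linearly independent over the
residue field. -/
abbrev Indep (d : Idx n) {k : ℕ} (x : Fin k → Idx n → R) : Prop :=
  LinearIndependent (ResidueField R) fun a => A.pr d (x a)

/-- The span over the residue field of the parts of the vectors `x a` supported on the class
of `d`. -/
noncomputable abbrev prSpan (d : Idx n) {k : ℕ} (x : Fin k → Idx n → R) :
    Submodule (ResidueField R) ({i // A.ν d i} → ResidueField R) :=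
  Submodule.span (ResidueField R) (Set.range fun a => A.pr d (x a))

theorem pr_mem_prSpan (d : Idx n) {k : ℕ} (x : Fin k → Idx n → R) (a : Fin k) :
    A.pr d (x a) ∈ A.prSpan d x := Submodule.subset_span ⟨a, rfl⟩

theorem prSpan_le {d : Idx n} {k l : ℕ} {x : Fin k → Idx n → R} {y : Fin l → Idx n → R}
    (h : ∀ a, A.pr d (x a) ∈ A.prSpan d y) : A.prSpan d x ≤ A.prSpan d y := by
  rw [prSpan, Submodule.span_le]
  rintro _ ⟨a, rfl⟩
  exact h a

theorem indep_cons {d : Idx n} {k : ℕ} {x : Fin k → Idx n → R} {y : Idx n → R}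
    (hx : A.Indep d x)
    (hy : A.pr d y ∉ A.prSpan d x) : A.Indep d (Matrix.vecCons y x) := by
  have h := linearIndependent_finCons.2 ⟨hx, hy⟩
  have e : (fun a => A.pr d ((Matrix.vecCons y x : Fin (k + 1) → _) a)) =
      Fin.cons (A.pr d y) fun a => A.pr d (x a) := by
    ext a : 1
    refine Fin.cases ?_ (fun a => ?_) a <;> rfl
  rw [Indep, e]
  exact h

theorem indep_empty {d : Idx n} :
    A.Indep d (![] : Fin 0 → Idx n → R) :=
  linearIndependent_empty_type

theorem indep_one {d : Idx n} {y : Idx n → R} (hy : A.pr d y ≠ 0) :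
    A.Indep d ![y] :=
  A.indep_cons A.indep_empty (by simpa [prSpan] using hy)

theorem exists_form_eq {d : Idx n} {k : ℕ} {x : Fin k → Idx n → R}
    (hx : A.Indep d x) (c : Fin k → R) :
    ∃ w, A.Supp (opp d) w ∧ ∀ a, form (x a) w = c a := by
  classical
  obtain ⟨u, hu⟩ := exists_solution (fun a (i : {i // A.ν d i}) => x a i) hx c
  exact ⟨A.spread d u, A.supp_spread d u, fun a => by rw [form_spread]; exact hu a⟩

/-- This is where the class size 5 enters: k exact conditions, l conditions modulo the maximal
ideal, and avoidance of a span of m vectors cost at most m + k + l dimensions. -/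
theorem exists_form_eq_zero_notMem {d : Idx n} (hd : ¬ A.ν d (opp d)) {k l m : ℕ}
    {x : Fin k → Idx n → R} (hx : A.Indep d x)
    (y : Fin l → Idx n → R) (u : Fin m → Idx n → R) (hm : m + k + l < 5) :
    ∃ w, A.Supp (opp d) w ∧ (∀ a, form (x a) w = 0) ∧ (∀ b, residue R (form (y b) w) = 0) ∧
      A.pr (opp d) w ∉ A.prSpan (opp d) u := by
  classical
  have hopp : ∀ j : {i // A.ν (opp d) i}, A.ν d (opp j) := fun j => by
    simpa [opp_opp] using A.hν _ _ j.2
  -- T is `spread` over the residue field; it transports the subspace to be avoided from the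
  -- coordinates of -d to those of d.
  set T : ({i // A.ν d i} → ResidueField R) →ₗ[ResidueField R]
      ({i // A.ν (opp d) i} → ResidueField R) :=
    { toFun := fun v j => residue R (sgn R (opp j.1)) * v ⟨opp j, hopp j⟩
      map_add' := fun v w => by ext; simp [mul_add]
      map_smul' := fun c v => by ext; simp; ring }
  have hT : Function.Injective T := by
    intro v w hvw
    ext ⟨i, hi⟩
    have h1 := congrFun hvw ⟨opp i, rel_opp hi⟩
    have h2 : residue R (sgn R (opp (opp i))) ≠ 0 :=
      (residue_ne_zero_iff_isUnit _).2 (isUnit_sgn _)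
    have h3 := mul_left_cancel₀ h2 h1
    simpa [opp_opp] using h3
  set W := Submodule.span (ResidueField R) (Set.range fun a => A.pr (opp d) (u a))
  have hW : finrank (ResidueField R) (W.comap T) ≤ m := by
    have h1 : finrank (ResidueField R) W ≤ m := by
      simpa [Set.finrank] using finrank_range_le_card (R := ResidueField R) fun a => A.pr (opp d) (u a)
    refine le_trans ?_ h1
    rw [(Submodule.equivMapOfInjective T hT (W.comap T)).finrank_eq]
    exact Submodule.finrank_mono (Submodule.map_comap_le _ _)
  have hcard : 5 ≤ Fintype.card {i // A.ν d i} := by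
    have h1 := A.le_encard_class hd
    have h2 : {x | A.ν x d}.encard = Fintype.card {i // A.ν d i} := by
      rw [show {x | A.ν x d} = {x | A.ν d x} from Set.ext fun x => A.ν.comm',
        Set.encard_eq_coe_toFinset_card, Set.toFinset_card]
      rfl
    rw [h2] at h1
    exact_mod_cast h1
  obtain ⟨v, h1, h2, h3⟩ := exists_solution_notMem (fun a (i : {i // A.ν d i}) => x a i) hx
    (fun b (i : {i // A.ν d i}) => y b i) (W.comap T) (by omega)
  refine ⟨A.spread d v, A.supp_spread d v, fun a => by rw [form_spread]; exact h1 a,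
    fun b => by rw [form_spread]; exact h2 b, fun h4 => h3 ?_⟩
  rw [Submodule.mem_comap]
  convert h4 using 1
  ext j
  simp [T, pr, spread, hopp j]

theorem exists_form_eq_opp {d : Idx n} {k : ℕ} {x : Fin k → Idx n → R}
    (hx : A.Indep (opp d) x) (c : Fin k → R) :
    ∃ w, A.Supp d w ∧ ∀ a, form (x a) w = c a := by
  have := A.exists_form_eq hx c
  rwa [opp_opp] at this

theorem exists_form_eq_zero_notMem_opp {d : Idx n} (hd : ¬ A.ν d (opp d)) {k l m : ℕ}
    {x : Fin k → Idx n → R} (hx : A.Indep (opp d) x)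
    (y : Fin l → Idx n → R) (u : Fin m → Idx n → R) (hm : m + k + l < 5) :
    ∃ w, A.Supp d w ∧ (∀ a, form (x a) w = 0) ∧ (∀ b, residue R (form (y b) w) = 0) ∧
      A.pr d w ∉ A.prSpan d u := by
  have := fun u => A.exists_form_eq_zero_notMem (A.not_self_opp hd) hx y (m := m) u hm
  rw [opp_opp] at this
  exact this u

theorem exists_ve_notMem {d : Idx n} (hd : ¬ A.ν d (opp d)) {m : ℕ} (u : Fin m → Idx n → R)
    (hm : m < 5) : ∃ i, A.ν d i ∧ A.pr d (ve i) ∉ A.prSpan d u := by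
  obtain ⟨w, hw, -, -, h⟩ := A.exists_form_eq_zero_notMem_opp hd A.indep_empty ![] u (by omega)
  by_contra! hc
  refine h ?_
  classical
  have h1 : A.pr d w = ∑ i, residue R (w i) • A.pr d (ve i) := by
    ext j
    simp [pr, Finset.sum_apply, ve_apply]
  rw [h1]
  refine Submodule.sum_mem _ fun i _ => ?_
  by_cases hi : A.ν d i
  · exact Submodule.smul_mem _ _ (hc i hi)
  · simp [hw i hi]

end Setting

end SpNet

/-! ### Transvections on a non-self-conjugate class -/

namespace SpNet

open IsLocalRing Module

namespace Setting

variable {n : ℕ} {R : Type*} [CommRing R] {A : Setting n R}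

theorem rel_zero_right (A : Setting n R) (x : Idx n → R) : A.Rel x 0 0 := by
  obtain ⟨l, hl, -⟩ := A.hS.2 0
  exact ⟨by simp, l, hl, fun r _ => ⟨1, one_mem _, fun v => by simp [act_one]⟩⟩

theorem Rel.sum {ι : Type*} {x : Idx n → R} {f : ι → Idx n → R} (s : Finset ι)
    (h : ∀ i ∈ s, A.Rel x (f i) 0) (hf : ∀ i ∈ s, ∀ j ∈ s, form (f i) (f j) = 0) :
    A.Rel x (∑ i ∈ s, f i) 0 := by
  classical
  induction s using Finset.induction_on with
  | empty => simpa using A.rel_zero_right x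
  | insert a s ha ih =>
    rw [Finset.sum_insert ha]
    refine Rel.add_zero_zero (h a (Finset.mem_insert_self _ _))
      (ih (fun i hi => h i (Finset.mem_insert_of_mem hi)) fun i hi j hj =>
        hf i (Finset.mem_insert_of_mem hi) j (Finset.mem_insert_of_mem hj)) ?_
    rw [map_sum]
    exact Finset.sum_eq_zero fun j hj =>
      hf a (Finset.mem_insert_self _ _) j (Finset.mem_insert_of_mem hj)

theorem ne_opp_of_rel {d i j : Idx n} (hd : ¬ A.ν d (opp d)) (hi : A.ν d i) (hj : A.ν d j) :
    i ≠ opp j := fun hij =>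
  hd (A.ν.trans' hi (by rw [hij]; exact rel_opp (A.ν.symm' hj)))

theorem Supp.apply_opp_eq_zero {d i : Idx n} (hd : ¬ A.ν d (opp d)) {v : Idx n → R}
    (hv : A.Supp d v) (hi : A.ν d i) : v (opp i) = 0 :=
  hv _ fun h => ne_opp_of_rel hd h hi rfl

theorem Supp.opp_apply_eq_zero {d i : Idx n} (hd : ¬ A.ν d (opp d)) {v : Idx n → R}
    (hv : A.Supp (opp d) v) (hi : A.ν d i) : v i = 0 :=
  hv _ fun h => hd (A.ν.trans' hi (A.ν.symm' h))

theorem rel_ve_opp {d i k : Idx n} (hi : A.ν d i) (hk : A.ν d k) (hik : i ≠ k) :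
    A.Rel (ve i) (ve (opp k)) 0 := by
  have := A.rel_ve (c := 1) hik (by rw [A.sigma_eq_top (A.ν.trans' (A.ν.symm' hi) hk)]; trivial)
  rwa [one_smul] at this

theorem rel_of_coords {d : Idx n} (hd : ¬ A.ν d (opp d)) {x y : Idx n → R} (hy : A.Supp d y)
    (h : ∀ i, A.ν d i → A.Rel x (y i • ve i) 0) : A.Rel x y 0 := by
  rw [← sum_smul_ve y]
  refine Rel.sum _ (fun i _ => ?_) fun i _ j _ => ?_
  · by_cases hi : A.ν d i
    · exact h i hi
    · rw [hy i hi, zero_smul]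
      exact A.rel_zero_right x
  · by_cases hi : A.ν d i
    · by_cases hj : A.ν d j
      · exact Supp.form_eq_zero hd ((Supp.ve hi).smul _) ((Supp.ve hj).smul _)
      · simp [hy j hj]
    · simp [hy i hi]

theorem rel_ve_supp {d k : Idx n} (hd : ¬ A.ν d (opp d)) (hk : A.ν d k) {x : Idx n → R}
    (hx : A.Supp d x) (hxk : x k = 0) : A.Rel (ve (opp k)) x 0 := by
  refine rel_of_coords hd hx fun i hi => ?_
  by_cases hik : i = k
  · rw [hik, hxk, zero_smul]
    exact A.rel_zero_right _
  · exact (rel_ve_opp hi hk hik).symm.smul_right _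

/-- With a free index k, the pair (x,x') comes from the commutator of the transvections (x, e_{-k})
and (e_k, x'). -/
theorem rel_of_supp_of_zero {d k : Idx n} (hd : ¬ A.ν d (opp d)) (hk : A.ν d k)
    {x x' : Idx n → R} (hx : A.Supp d x) (hx' : A.Supp (opp d) x') (h : form x x' = 0)
    (hxk : x k = 0) (hxk' : x' (opp k) = 0) : A.Rel x x' 0 := by
  have h1 : A.Rel (ve k) x' 0 := by
    have := rel_ve_supp (A.not_self_opp hd) (rel_opp hk) hx' hxk'
    rwa [opp_opp] at this
  have h2 := h1.symm.comm_rel (rel_ve_supp hd hk hx hxk).symm h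
    (by simp [hx'.opp_apply_eq_zero hd hk]) (by simp [hx.apply_opp_eq_zero hd hk])
  refine (h2.of_unit_smul_right ?_).symm
  simpa using isUnit_sgn _

/-- Up to denominators the overgroup contains all transvections attached to orthogonal vectors
`x` and `x'` supported on the classes of `d` and `-d`, if `x` is unimodular. -/
theorem rel_of_supp {d i : Idx n} (hd : ¬ A.ν d (opp d)) (hi : A.ν d i) {x x' : Idx n → R}
    (hx : A.Supp d x) (hx' : A.Supp (opp d) x') (h : form x x' = 0) (hxi : IsUnit (x i)) :
    A.Rel x x' 0 := by
  obtain ⟨u, hu⟩ := ((isUnit_sgn i).mul hxi).exists_right_inv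
  -- π is the projection onto the orthogonal complement of x along e_{-i}. It fixes x', so x' is a
  -- combination of the vectors π(e_{-j}), each living on the two indices -i and -j only.
  set π : (Idx n → R) →ₗ[R] (Idx n → R) := LinearMap.id - (u • form x).smulRight (ve (opp i))
  have hπ : ∀ w, π w = w - (u * form x w) • ve (opp i) := fun w => rfl
  have hπx : ∀ w, form x (π w) = 0 := fun w => by
    rw [hπ]
    simp [sgn_opp]
    linear_combination (- form x w) * hu
  have hsupp : ∀ j, A.ν d j → A.Supp (opp d) (π (ve (opp j))) := fun j hj =>
    (Supp.ve (rel_opp hj)).sub ((Supp.ve (rel_opp hi)).smul _)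
  have key : ∀ j, A.ν d j → A.Rel x (π (ve (opp j))) 0 := by
    intro j hj
    by_cases hji : j = i
    · have : π (ve (opp j)) = 0 := by
        rw [hπ, hji]
        simp only [form_ve_right, opp_opp, sgn_opp]
        rw [show u * -(-sgn R i * x i) = 1 by linear_combination hu, one_smul, sub_self]
      rw [this]
      exact A.rel_zero_right x
    obtain ⟨k, hk, hkn⟩ := A.exists_rel_of_not_self hd {i, j}
      (Finset.card_le_two.trans_lt (by norm_num))
    simp only [Finset.mem_insert, Finset.mem_singleton, not_or] at hkn
    have hyk : ∀ k, k ≠ i → k ≠ j → π (ve (opp j)) (opp k) = 0 := fun k h1 h2 => by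
      rw [hπ]
      simp [ve_of_ne (fun h => h1 ((opp_eq_iff _ _).1 h)),
        ve_of_ne (fun h => h2 ((opp_eq_iff _ _).1 h))]
    -- z is the part of x on the indices i, j. The rest of x is treated coordinatewise, and z
    -- through a third index k at which both vectors vanish.
    set z : Idx n → R := x i • ve i + x j • ve j
    have hz : A.Supp d z := ((Supp.ve hi).smul _).add ((Supp.ve hj).smul _)
    have hzi : z i = x i := by simp [z, ve_of_ne (Ne.symm hji)]
    have hzj : z j = x j := by simp [z, ve_of_ne hji]
    have h1 : A.Rel (π (ve (opp j))) (x - z) 0 := by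
      refine rel_of_coords hd (hx.sub hz) fun k hk => ?_
      by_cases hki : k = i
      · rw [hki, Pi.sub_apply, hzi, sub_self, zero_smul]
        exact A.rel_zero_right _
      by_cases hkj : k = j
      · rw [hkj, Pi.sub_apply, hzj, sub_self, zero_smul]
        exact A.rel_zero_right _
      refine Rel.smul_right ?_ _
      have := rel_ve_supp (A.not_self_opp hd) (rel_opp hk) (hsupp j hj) (hyk k hki hkj)
      rw [opp_opp] at this
      exact this.symm
    have h2 : A.Rel z (π (ve (opp j))) 0 := by
      refine rel_of_supp_of_zero hd hk hz (hsupp j hj) ?_ ?_ (hyk k hkn.1 hkn.2)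
      · have h3 := hπx (ve (opp j))
        have h4 := form_eq_zero_swap h1.1
        rw [map_sub, LinearMap.sub_apply, h3] at h4
        simpa using h4
      · simp [z, ve_of_ne hkn.1, ve_of_ne hkn.2]
    have h3 := h1.add_zero_zero h2.symm (Supp.form_eq_zero hd (hx.sub hz) hz)
    rw [sub_add_cancel] at h3
    exact h3.symm
  have h1 : π x' = x' := by rw [hπ, h]; simp
  rw [← h1, ← sum_smul_ve x', map_sum]
  simp only [map_smul]
  have hd' := A.not_self_opp hd
  refine Rel.sum _ (fun m _ => ?_) fun m _ m' _ => ?_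
  · by_cases hm : A.ν (opp d) m
    · have := key (opp m) (by simpa [opp_opp] using A.hν _ _ hm)
      rw [opp_opp] at this
      exact this.smul_right _
    · rw [hx' m hm, zero_smul]
      exact A.rel_zero_right _
  · by_cases hm : A.ν (opp d) m
    · by_cases hm' : A.ν (opp d) m'
      · have e : ∀ m, A.ν (opp d) m → A.Supp (opp d) (π (ve m)) := fun m hm => by
          have := hsupp (opp m) (by simpa [opp_opp] using A.hν _ _ hm)
          rwa [opp_opp] at this
        exact Supp.form_eq_zero hd' ((e m hm).smul _) ((e m' hm').smul _)
      · simp [hx' m' hm']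
    · simp [hx' m hm]

variable [IsLocalRing R]

theorem rel_of_pr {d : Idx n} (hd : ¬ A.ν d (opp d)) {x x' : Idx n → R}
    (hx : A.Supp d x) (hx' : A.Supp (opp d) x') (h : form x x' = 0) (hxi : A.pr d x ≠ 0) :
    A.Rel x x' 0 := by
  obtain ⟨i, hi, hu⟩ := A.exists_isUnit_of_pr_ne_zero hxi
  exact rel_of_supp hd hi hx hx' h hu

theorem prSpan_tail_le {d : Idx n} {k : ℕ} (y : Idx n → R) (x : Fin k → Idx n → R) :
    A.prSpan d x ≤ A.prSpan d (Matrix.vecCons y x) :=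
  prSpan_le A fun a => A.pr_mem_prSpan d (Matrix.vecCons y x) a.succ

theorem pr_ne_zero_of_notMem {d : Idx n} {k : ℕ} {y : Idx n → R} {x : Fin k → Idx n → R}
    (h : A.pr d y ∉ A.prSpan d x) : A.pr d y ≠ 0 := fun h0 => h (h0 ▸ Submodule.zero_mem _)

/-- Two commutators replace x, then v, by basis vectors e_j, e_i of the class. Independence supplies
dual vectors pairing to 1 with the vector being replaced and to 0 with the others, so c is preserved
up to sign. -/
theorem mem_sigma_of_rel_supp {d : Idx n} (hd : ¬ A.ν d (opp d)) {x v : Idx n → R} {c : R}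
    (hx : A.Supp d x) (hv : A.Supp d v) (hxv : A.Indep d ![v, x]) (h : A.Rel x (c • v) 0) :
    c ∈ A.net.σ d (opp d) := by
  obtain ⟨j, hj, hjn⟩ := A.exists_ve_notMem hd ![v, x] (by norm_num)
  obtain ⟨w, hw, hwf⟩ := A.exists_form_eq (A.indep_cons hxv hjn) ![0, 0, 1]
  have w0 : form (ve j) w = 0 := hwf 0
  have w1 : form v w = 0 := hwf 1
  have w2 : form x w = 1 := hwf 2
  have h1 := h.symm.comm_rel (rel_of_pr hd (Supp.ve hj) hw w0 (pr_ne_zero_of_notMem hjn))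
    (by rw [map_smul, Supp.form_eq_zero hd (Supp.ve hj) hv, smul_zero])
    (by rw [map_smul, form_eq_zero_swap w1, smul_zero]) (Supp.form_eq_zero hd (Supp.ve hj) hx)
  rw [form_swap, w2] at h1
  have h2 : A.Rel (ve j) (c • v) 0 := (h1.of_unit_smul_right isUnit_one.neg).symm
  have hvj : A.Indep d ![v, ve j] := by
    refine A.indep_cons (A.indep_one (pr_ne_zero_of_notMem hjn)) fun hc => ?_
    have h3 : A.pr d v ≠ 0 := by
      have := hxv.ne_zero 0
      exact this
    have hc' : A.pr d v ∈ Submodule.span (ResidueField R) {A.pr d (ve j)} := by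
      simpa [prSpan] using hc
    obtain ⟨b, hb⟩ := Submodule.mem_span_singleton.1 hc'
    refine hjn ?_
    have hb0 : b ≠ 0 := fun hb0 => h3 (by rw [← hb, hb0, zero_smul])
    have hm : A.pr d v ∈ A.prSpan d ![v, x] := A.pr_mem_prSpan d ![v, x] 0
    rw [← hb] at hm
    exact (Submodule.smul_mem_iff _ hb0).1 hm
  obtain ⟨i, hi, hin⟩ := A.exists_ve_notMem hd ![v, ve j] (by norm_num)
  obtain ⟨w', hw', hwf'⟩ := A.exists_form_eq (A.indep_cons hvj hin) ![0, 1, 0]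
  have w0' : form (ve i) w' = 0 := hwf' 0
  have w1' : form v w' = 1 := hwf' 1
  have w2' : form (ve j) w' = 0 := hwf' 2
  have h3 := h2.comm_rel (rel_of_pr hd (Supp.ve hi) hw' w0' (pr_ne_zero_of_notMem hin))
    (Supp.form_eq_zero hd (Supp.ve hi) (Supp.ve hj)) (form_eq_zero_swap w2')
    (by rw [map_smul, Supp.form_eq_zero hd (Supp.ve hi) hv, smul_zero])
  rw [map_smul, form_swap, w1'] at h3
  have h4 := h3.symm
  rw [← opp_opp j] at h4
  have h5 := A.mem_sigma_of_rel (ne_opp_of_rel hd hi hj) (by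
    rw [opp_opp]
    rintro rfl
    exact hin (A.pr_mem_prSpan d ![v, ve i] 1)) h4
  rw [smul_eq_mul, mul_neg, mul_one, neg_mem_iff] at h5
  exact A.sigma_le_of_rel (A.ν.symm' hi) (rel_opp (A.ν.symm' hj)) h5

/-- Conjugating a pair (x,x') by h, with x orthogonal to Q, gives (x + εQ, x' + δP), where δ =
B(Q,x') is the scalar sought. Commutators then extract δ: one pairs x' + δP with a vector w on -d
that sees only P, the other replaces the left vector by one supported on d. -/
theorem form_mem_sigma_of_generic {d : Idx n} (hd : ¬ A.ν d (opp d)) {P Q x' : Idx n → R}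
    {h : Sp n R} (hh : h ∈ A.H) (hT : IsTrans h P Q 0) (hP : A.pr d P ≠ 0)
    (hQ : A.pr (opp d) Q ≠ 0) (hx' : A.Supp (opp d) x') (hPx' : form P x' = 0)
    (hgen : A.pr (opp d) x' ∉ A.prSpan (opp d) ![P, Q]) :
    form Q x' ∈ A.net.σ d (opp d) := by
  have hd' := A.not_self_opp hd
  set δ := form Q x'
  obtain ⟨x, hx, hxf, -, hxn⟩ := A.exists_form_eq_zero_notMem_opp hd
    (A.indep_cons (A.indep_one hQ) fun h => hgen (prSpan_tail_le P ![Q] h)) ![] ![P, Q]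
    (by norm_num)
  have f1 : form x' x = 0 := hxf 0
  have f2 : form Q x = 0 := hxf 1
  set ε := form P x
  have hconj := (rel_of_pr hd hx hx' (form_eq_zero_swap f1) (pr_ne_zero_of_notMem hxn)).conj hh
  have e1 : act h x = x + ε • Q := by rw [hT]; simp [f2, ε]
  have e2 : act h x' = x' + δ • P := by rw [hT]; simp [hPx', δ]
  rw [e1, e2] at hconj
  set x1 := x + ε • Q
  set x1' := x' + δ • P
  have g1 : A.pr (opp d) x1' ∉ A.prSpan (opp d) ![Q] := fun hc => by
    refine hgen ?_
    have h1 : A.pr (opp d) x' = A.pr (opp d) x1' - residue R δ • A.pr (opp d) P := by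
      rw [A.pr_add, A.pr_smul, add_sub_cancel_right]
    rw [h1]
    exact Submodule.sub_mem _ (prSpan_tail_le P ![Q] hc)
      (Submodule.smul_mem _ _ (A.pr_mem_prSpan _ ![P, Q] 0))
  have g2 : A.pr d x1 ∉ A.prSpan d ![P] := fun hc => by
    refine hxn ?_
    have h1 : A.pr d x = A.pr d x1 - residue R ε • A.pr d Q := by
      rw [A.pr_add, A.pr_smul, add_sub_cancel_right]
    have h2 : A.prSpan d ![P] ≤ A.prSpan d ![P, Q] := prSpan_le A fun a => by
      fin_cases a
      exact A.pr_mem_prSpan d ![P, Q] 0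
    rw [h1]
    exact Submodule.sub_mem _ (h2 hc) (Submodule.smul_mem _ _ (A.pr_mem_prSpan _ ![P, Q] 1))
  obtain ⟨x2, hx2, hx2f, -, hx2n⟩ := A.exists_form_eq_zero_notMem_opp hd
    (A.indep_cons (A.indep_one hQ) g1) ![] ![x1, P] (by norm_num)
  have f3 : form x1' x2 = 0 := hx2f 0
  have f4 : form Q x2 = 0 := hx2f 1
  have f5 : form x1 x2 = 0 := by
    simp [x1, f4, Supp.form_eq_zero hd hx hx2]
  obtain ⟨w, hw, hwf⟩ := A.exists_form_eq (A.indep_cons (A.indep_cons (A.indep_one hP) g2) hx2n)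
    ![0, 0, 1]
  have w0 : form x2 w = 0 := hwf 0
  have w1 : form x1 w = 0 := hwf 1
  have w2 : form P w = 1 := hwf 2
  have h1 := (rel_of_pr hd hx2 hw w0 (pr_ne_zero_of_notMem hx2n)).comm_rel hconj f5 f3 w1
  have h2 : form x1' w = δ := by
    simp [x1', w2, Supp.form_eq_zero hd' hx' hw]
  rw [h2] at h1
  -- The vector x1 involves Q and so need not be supported on d. It is exchanged for v by a
  -- commutator with (v,v'), where v' is orthogonal to v and x2 and pairs to 1 with x1.
  obtain ⟨v, hv, hvf, -, hvn⟩ := A.exists_form_eq_zero_notMem_opp hd (A.indep_one hQ) ![]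
    ![x2, x1] (by norm_num)
  have f6 : form Q v = 0 := hvf 0
  have g3 : A.pr d x2 ∉ A.prSpan d ![x1] := fun hc => hx2n (prSpan_le A (fun a => by
    fin_cases a
    exact A.pr_mem_prSpan d ![x1, P] 0) hc)
  obtain ⟨v', hv', hvf'⟩ := A.exists_form_eq
    (A.indep_cons (A.indep_cons (A.indep_one (pr_ne_zero_of_notMem g2)) g3) hvn) ![0, 0, 1]
  have v0 : form v v' = 0 := hvf' 0
  have v1 : form x2 v' = 0 := hvf' 1
  have v2 : form x1 v' = 1 := hvf' 2
  have h3 := h1.comm_rel (rel_of_pr hd hv hv' v0 (pr_ne_zero_of_notMem hvn))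
    (Supp.form_eq_zero hd hv hx2) (form_eq_zero_swap v1)
    (by simp [x1, Supp.form_eq_zero hd hv hx, form_eq_zero_swap f6])
  rw [map_smul, form_swap, v2] at h3
  have g4 : A.pr d v ∉ A.prSpan d ![x2] := fun hc => hvn (prSpan_le A (fun a => by
    fin_cases a
    exact A.pr_mem_prSpan d ![x2, x1] 0) hc)
  have h4 := mem_sigma_of_rel_supp hd hx2 hv
    (A.indep_cons (A.indep_one (pr_ne_zero_of_notMem g3)) g4) h3
  rwa [smul_eq_mul, mul_neg, mul_one, neg_mem_iff] at h4

/-- The conclusion is additive in x', so a degenerate x' is written as the difference of two generic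
vectors orthogonal to P. -/
theorem form_mem_sigma {d : Idx n} (hd : ¬ A.ν d (opp d)) {P Q x' : Idx n → R}
    {h : Sp n R} (hh : h ∈ A.H) (hT : IsTrans h P Q 0) (hP : A.pr d P ≠ 0)
    (hQ : A.pr (opp d) Q ≠ 0) (hx' : A.Supp (opp d) x') (hPx' : form P x' = 0) :
    form Q x' ∈ A.net.σ d (opp d) := by
  by_cases hgen : A.pr (opp d) x' ∈ A.prSpan (opp d) ![P, Q]
  · obtain ⟨x₀, hx₀, hf, -, hn⟩ := A.exists_form_eq_zero_notMem hd (A.indep_one hP) ![] ![P, Q]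
      (by norm_num)
    have f0 : form P x₀ = 0 := hf 0
    have h1 := form_mem_sigma_of_generic hd hh hT hP hQ hx₀ f0 hn
    have h2 := form_mem_sigma_of_generic hd hh hT hP hQ (hx'.add hx₀) (by simp [hPx', f0])
      (fun hc => hn (by
        rw [A.pr_add] at hc
        exact (Submodule.add_mem_iff_right _ hgen).1 hc))
    rw [map_add] at h2
    exact (Ideal.add_mem_iff_left _ h1).1 h2
  · exact form_mem_sigma_of_generic hd hh hT hP hQ hx' hPx' hgen

end Setting

end SpNet

namespace SpNet

open IsLocalRing Module

/-! ### The half form and the splitting of long transvections -/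

section LowerForm

variable {R : Type*} [CommRing R] {n : ℕ}

/-- The bilinear form `∑_{j > 0} v_j w_{-j}`. -/
def halfForm : (Idx n → R) →ₗ[R] (Idx n → R) →ₗ[R] R :=
  LinearMap.mk₂ R (fun v w => ∑ j : Fin n, v (Sum.inl j) * w (Sum.inr j))
    (fun v v' w => by simp [add_mul, Finset.sum_add_distrib])
    (fun c v w => by
      simp only [Pi.smul_apply, smul_eq_mul, Finset.mul_sum]
      exact Finset.sum_congr rfl fun i _ => by ring)
    (fun v w w' => by simp [mul_add, Finset.sum_add_distrib])
    (fun c v w => by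
      simp only [Pi.smul_apply, smul_eq_mul, Finset.mul_sum]
      exact Finset.sum_congr rfl fun i _ => by ring)

theorem halfForm_apply (v w : Idx n → R) :
    halfForm v w = ∑ j : Fin n, v (Sum.inl j) * w (Sum.inr j) := rfl

theorem form_eq_halfForm (v w : Idx n → R) : form v w = halfForm v w - halfForm w v := by
  rw [form_apply, Fintype.sum_sum_type, halfForm_apply, halfForm_apply]
  simp [sgn, mul_comm, sub_eq_add_neg]

theorem form_ve_ve {i j : Idx n} (h : opp i ≠ j) : form (ve i) (ve j : Idx n → R) = 0 := by
  rw [form_ve_left, ve_of_ne h, mul_zero]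

theorem halfForm_self_eq_zero {v : Idx n → R} (h : ∀ m, v m = 0 ∨ v (opp m) = 0) :
    halfForm v v = 0 := by
  rw [halfForm_apply]
  refine Finset.sum_eq_zero fun j _ => ?_
  rcases h (Sum.inl j) with h | h
  · rw [h, zero_mul]
  · rw [show v (Sum.inr j) = 0 from h, mul_zero]

theorem halfForm_add_self (v w : Idx n → R) :
    halfForm (v + w) (v + w) = halfForm v v + halfForm w w + form v w + 2 * halfForm w v := by
  rw [form_eq_halfForm]
  simp only [map_add, LinearMap.add_apply]
  ring

/-- The long transvection along x + y is the product of those along x and y and of a mixed one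
attached to (x, γy). -/
theorem IsTrans.of_add {a b c : Sp n R} {x y : Idx n → R} {γ : R} (hxy : form x y = 0)
    (h1 : IsTrans a x 0 γ) (h2 : IsTrans b (x + y) 0 γ) (h3 : IsTrans c x (γ • y) 0) :
    IsTrans (c⁻¹ * a⁻¹ * b) y 0 γ := by
  intro v
  have h : act b v = act a (act c (v + form 0 v • y + form y v • 0 + (γ * form y v) • y)) := by
    rw [h1, h2, h3]
    simp only [map_add, map_smul, map_zero, LinearMap.add_apply, LinearMap.smul_apply,
      LinearMap.zero_apply, smul_eq_mul, hxy, form_self]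
    module
  rw [act_mul, act_mul, h, act_inv_act, act_inv_act]

end LowerForm

/-! ### Sparse vectors and the coordinates read off with their help -/

namespace Setting

variable {n : ℕ} {R : Type*} [CommRing R] {A : Setting n R}

theorem Rel.slide {x y : Idx n → R} {c : R} (h : A.Rel (c • x) y 0) (hxy : form x y = 0) :
    A.Rel x (c • y) 0 := by
  obtain ⟨-, l, hl, h⟩ := h
  refine ⟨by rw [map_smul, hxy, smul_zero], l, hl, fun r hr => ?_⟩
  obtain ⟨g, hg, hg1⟩ := h r hr
  refine ⟨g, hg, ?_⟩
  rw [smul_comm, IsTrans.smul_left, mul_zero] at hg1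
  exact hg1

theorem Rel.zero_two_mul {x : Idx n → R} {c : R} (h : A.Rel x (c • x) 0) : A.Rel x 0 (2 * c) := by
  obtain ⟨-, l, hl, h⟩ := h
  refine ⟨by simp, l, hl, fun r hr => ?_⟩
  obtain ⟨g, hg, hg1⟩ := h (r ^ 2 * l) (mul_mem (pow_mem hr 2) (A.hS.1 l hl).1)
  refine ⟨g, hg, ?_⟩
  rw [IsTrans.smul_left, smul_smul, mul_zero] at hg1
  rw [IsTrans.smul_left, smul_zero]
  rw [← zero_add (_ • x), IsTrans.add_smul] at hg1
  convert hg1 using 1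
  ring

/-- The multiples are chosen so that all three transvections carry the same scalar s. The mixed one
needs s on both of its vectors, hence s² in total. -/
theorem Rel.of_add {x y : Idx n → R} {γ : R} (hxy : form x y = 0) (h1 : A.Rel x 0 γ)
    (h2 : A.Rel (x + y) 0 γ) (h3 : A.Rel x (γ • y) 0) : A.Rel y 0 γ := by
  obtain ⟨-, l, hl, h1⟩ := h1
  obtain ⟨-, l', hl', h2⟩ := h2
  obtain ⟨-, l'', hl'', h3⟩ := h3
  obtain ⟨z, hz, t, rfl⟩ := A.hS.exists_mul hl hl'
  obtain ⟨z', hz', t', rfl⟩ := A.hS.exists_mul hz hl''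
  have hl := (A.hS.1 _ hl).1
  have hl' := (A.hS.1 _ hl').1
  have hl'' := (A.hS.1 _ hl'').1
  refine ⟨by simp, _, hz', fun r hr => ?_⟩
  set s := r * (t' * (t * (l * l') * l''))
  obtain ⟨a, ha, ha1⟩ := h1 (r * t' * t * l' * l'') (⟨r, hr⟩ * t' * t * ⟨l', hl'⟩ * ⟨l'', hl''⟩ : A.R').2
  obtain ⟨b, hb, hb1⟩ := h2 (r * t' * t * l * l'') (⟨r, hr⟩ * t' * t * ⟨l, hl⟩ * ⟨l'', hl''⟩ : A.R').2
  have hs : s ∈ A.R' := 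
    (⟨r, hr⟩ * (t' * (t * (⟨l, hl⟩ * ⟨l', hl'⟩) * ⟨l'', hl''⟩)) : A.R').2
  obtain ⟨c, hc, hc1⟩ := h3 (s * (r * t' * t * l * l')) 
    (⟨s, hs⟩ * (⟨r, hr⟩ * t' * t * ⟨l, hl⟩ * ⟨l', hl'⟩) : A.R').2
  rw [show r * t' * t * l' * l'' * l = s by simp only [s]; ring] at ha1
  rw [show r * t' * t * l * l'' * l' = s by simp only [s]; ring, smul_add] at hb1
  rw [show s * (r * t' * t * l * l') * l'' = s * s by simp only [s]; ring, ← smul_smul,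
    IsTrans.smul_left, mul_zero, smul_comm] at hc1
  exact ⟨_, mul_mem (mul_mem (inv_mem hc) (inv_mem ha)) hb,
    IsTrans.of_add (by simp [hxy]) ha1 hb1 hc1⟩

/-- All coordinates of `v` lie in the column of the net that belongs to the class of `d`. -/
def InCol (A : Setting n R) (d : Idx n) (v : Idx n → R) : Prop := ∀ l, v l ∈ A.net.σ l d

namespace InCol

variable {d : Idx n} {v w : Idx n → R}

theorem add (hv : A.InCol d v) (hw : A.InCol d w) : A.InCol d (v + w) :=
  fun l => add_mem (hv l) (hw l)

theorem sub (hv : A.InCol d v) (hw : A.InCol d w) : A.InCol d (v - w) :=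
  fun l => sub_mem (hv l) (hw l)

theorem smul (c : R) (hv : A.InCol d v) : A.InCol d (c • v) :=
  fun l => Ideal.mul_mem_left _ c (hv l)

theorem smul_ve {l : Idx n} {c : R} (hc : c ∈ A.net.σ l d) : A.InCol d (c • ve l) := fun m => by
  by_cases h : m = l
  · subst h; simpa using hc
  · simp [ve_of_ne h]

theorem halfForm_mem (hv : A.InCol d v) (hw : A.InCol d w) :
    halfForm v w ∈ A.net.σ (opp d) d := by
  rw [halfForm_apply]
  refine sum_mem fun j _ => ?_
  have h1 := hv (Sum.inl j)
  rw [← A.mem_sigma_opp] at h1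
  exact A.mul_mem_sigma h1 (hw (Sum.inr j))

theorem two_mul_halfForm_mem (hv : A.InCol d v) (hw : A.InCol d w) :
    2 * halfForm v w ∈ A.net.Γ (opp d) :=
  A.net.two_mul_mem _ _ (by rw [opp_opp]; exact hv.halfForm_mem hw)

end InCol

/-- The row index and coefficient data of a vector `e_{-k} - c e_{-i} - δ e_j`. -/
structure Triple (A : Setting n R) (d : Idx n) where
  /-- first index -/
  i : Idx n
  /-- second index -/
  j : Idx n
  /-- third index -/
  k : Idx n
  /-- auxiliary index -/
  t : Idx n
  hi : A.ν d i
  hj : A.ν d j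
  hk : A.ν d k
  ht : A.ν d t
  hij : i ≠ j
  hik : i ≠ k
  hjk : j ≠ k
  hti : t ≠ i
  htj : t ≠ j
  htk : t ≠ k
  /-- a coefficient in the ring -/
  c : R
  /-- a coefficient in the net -/
  δ : R
  hδ : δ ∈ A.net.σ d (opp d)

namespace Triple

variable {d : Idx n} (X : A.Triple d)

/-- The vector `e_{-k} - c e_{-i} - δ e_j`. -/
def vec : Idx n → R := ve (opp X.k) - X.c • ve (opp X.i) - X.δ • ve X.j

theorem vec_eq : X.vec = ve (opp X.k) + ((-X.c) • ve (opp X.i) + (-X.δ) • ve X.j) := by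
  rw [vec]; module

theorem rel_vec (hd : ¬ A.ν d (opp d)) {y : Idx n → R} (h1 : A.Rel y (ve (opp X.k)) 0)
    (h2 : A.Rel y (ve (opp X.i)) 0) (h3 : A.Rel y (X.δ • ve X.j) 0) : A.Rel X.vec y 0 := by
  have e1 : form (ve (opp X.i)) (ve X.j : Idx n → R) = 0 :=
    form_ve_ve (by rw [opp_opp]; exact X.hij)
  have e2 : form (ve (opp X.k)) (ve X.j : Idx n → R) = 0 :=
    form_ve_ve (by rw [opp_opp]; exact X.hjk.symm)
  have e3 : form (ve (opp X.k)) (ve (opp X.i) : Idx n → R) = 0 :=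
    form_ve_ve (by rw [opp_opp]; exact ne_opp_of_rel hd X.hk X.hi)
  have h3' : A.Rel y ((-X.δ) • ve X.j) 0 := by
    have := h3.smul_right (-1)
    rwa [smul_smul, neg_one_mul] at this
  rw [vec_eq]
  refine (h1.add_zero_zero ((h2.smul_right (-X.c)).add_zero_zero h3' ?_) ?_).symm
  · simp only [map_smul, LinearMap.smul_apply, e1, smul_zero]
  · simp only [map_add, map_smul, e2, e3, smul_zero, add_zero]

/-- The excluded indices i, k, -j are those where e_l may fail to be orthogonal to a term of `vec`.
For the term δe_j, the coefficient δ is moved onto c, since cδ ∈ σ_{l,-j}. -/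
theorem rel_ve_vec (hd : ¬ A.ν d (opp d)) {l : Idx n} {c : R} (hc : c ∈ A.net.σ l d)
    (hli : l ≠ X.i) (hlk : l ≠ X.k) (hlj : l ≠ opp X.j) : A.Rel X.vec (c • ve l) 0 := by
  refine X.rel_vec hd (A.rel_ve hlk ?_) (A.rel_ve hli ?_) ?_
  · exact A.sigma_le_of_rel (A.ν.refl' _) X.hk hc
  · exact A.sigma_le_of_rel (A.ν.refl' _) X.hi hc
  · have h1 : X.δ * c ∈ A.net.σ l (opp X.j) := by
      rw [mul_comm]
      exact A.mul_mem_sigma hc (A.sigma_le_of_rel (A.ν.refl' _) (rel_opp X.hj) X.hδ)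
    have h2 := A.rel_ve hlj h1
    rw [opp_opp] at h2
    have h3 : form (ve l) (ve X.j : Idx n → R) = 0 :=
      form_ve_ve fun h => hlj (by rw [← h, opp_opp])
    refine Rel.slide ?_ (by simp only [map_smul, LinearMap.smul_apply, h3, smul_zero])
    rwa [smul_smul]

theorem vec_apply_t (hd : ¬ A.ν d (opp d)) : X.vec X.t = 0 := by
  simp [vec, ve_of_ne (ne_opp_of_rel hd X.ht X.hk), ve_of_ne (ne_opp_of_rel hd X.ht X.hi),
    ve_of_ne X.htj]

theorem vec_apply_k (hd : ¬ A.ν d (opp d)) : X.vec X.k = 0 := by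
  simp [vec, ve_of_ne (ne_opp_of_rel hd X.hk X.hk), ve_of_ne (ne_opp_of_rel hd X.hk X.hi),
    ve_of_ne X.hjk.symm]

theorem vec_apply_i (hd : ¬ A.ν d (opp d)) : X.vec X.i = 0 := by
  simp [vec, ve_of_ne (ne_opp_of_rel hd X.hi X.hk), ve_of_ne (ne_opp_of_rel hd X.hi X.hi),
    ve_of_ne X.hij]

theorem vec_apply_opp_k (hd : ¬ A.ν d (opp d)) : X.vec (opp X.k) = 1 := by
  have h1 : opp X.k ≠ opp X.i := fun h => X.hik ((opp_eq_iff _ _).1 h).symm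
  simp [vec, ve_of_ne h1, ve_of_ne (ne_opp_of_rel hd X.hj X.hk).symm]

theorem vec_apply_other {m : Idx n} (h1 : ¬ A.ν d m) (h2 : ¬ A.ν (opp d) m) : X.vec m = 0 := by
  have e1 : m ≠ opp X.k := by rintro rfl; exact h2 (rel_opp X.hk)
  have e2 : m ≠ opp X.i := by rintro rfl; exact h2 (rel_opp X.hi)
  have e3 : m ≠ X.j := by rintro rfl; exact h1 X.hj
  simp [vec, ve_of_ne e1, ve_of_ne e2, ve_of_ne e3]

/-- The coordinate P_l is isolated on some e_m with m ∼ l. Then the coordinate 1 of `vec` at -k is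
moved to e_{-t}, leaving a transvection of two basis vectors. -/
theorem mem_sigma (hd : ¬ A.ν d (opp d)) {P : Idx n → R} {α : R} (h : A.Rel X.vec P α) {l : Idx n}
    (h1 : ¬ A.ν d l) (h2 : ¬ A.ν (opp d) l) : P l ∈ A.net.σ l d := by
  have n1 : ∀ m, A.ν l m → ¬ A.ν d m := fun m hm hdm => h1 (A.ν.trans' hdm (A.ν.symm' hm))
  have n2 : ∀ m, A.ν l m → ¬ A.ν (opp d) m := fun m hm hdm =>
    h2 (A.ν.trans' hdm (A.ν.symm' hm))
  obtain ⟨m, hm, h3⟩ := h.extract (l := l) (fun m hm => X.vec_apply_other (n1 m hm) (n2 m hm))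
    (fun m hm => by
      have hm' : A.ν l (opp m) := by simpa [opp_opp] using A.hν _ _ hm
      refine X.vec_apply_other (fun h => ?_) (fun h => ?_)
      · exact n2 _ hm' (rel_opp h)
      · exact n1 _ hm' (by simpa [opp_opp] using A.hν _ _ h))
  have e1 : opp X.k ≠ m := by rintro rfl; exact n2 _ hm (rel_opp X.hk)
  have e2 : X.t ≠ m := by rintro rfl; exact n1 _ hm X.ht
  have e3 : m ≠ opp X.t := by rintro rfl; exact n2 _ hm (rel_opp X.ht)
  have h4 := h3.symm.short_single (s := opp X.t) (r := opp X.k)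
    (rel_opp (A.ν.trans' (A.ν.symm' X.ht) X.hk)) (fun h => X.htk ((opp_eq_iff _ _).1 h))
    (by rw [opp_opp]; exact (ne_opp_of_rel hd X.hk X.ht).symm) (by simp [ve_of_ne e1])
    (by rw [opp_opp]; simp [ve_of_ne e2]) (by rw [opp_opp]; exact X.vec_apply_t hd)
  rw [X.vec_apply_opp_k hd, one_smul] at h4
  exact A.sigma_le_of_rel (A.ν.symm' hm) (A.ν.symm' X.ht) (A.mem_sigma_of_rel e2.symm e3 h4)

/-- Multiplying the transvections gives a long part that differs from the half form of y + y' by 2τ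
with τ = halfForm y' y. As τ lies in σ_{-d,d}, the transvection attached to (vec, τ vec), which is
long with coefficient 2τ, makes up the difference. -/
theorem rel_vec_halfForm_add (hd : ¬ A.ν d (opp d)) {y y' : Idx n → R} (hy : A.InCol d y)
    (hy' : A.InCol d y') (h : A.Rel X.vec y (halfForm y y)) (h' : A.Rel X.vec y' (halfForm y' y')) :
    A.Rel X.vec (y + y') (halfForm (y + y') (y + y')) := by
  have h1 : A.Rel X.vec (halfForm y' y • X.vec) 0 := by
    have h2 := hy'.halfForm_mem hy
    set τ := halfForm y' y
    refine X.rel_vec hd ?_ ?_ ?_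
    · have h3 := X.rel_ve_vec hd (l := opp X.k) (c := τ)
        (A.sigma_le_of_rel (rel_opp X.hk) (A.ν.refl' _) h2) (ne_opp_of_rel hd X.hi X.hk).symm
        (ne_opp _).symm (fun h => X.hjk ((opp_eq_iff _ _).1 h).symm)
      refine (h3.symm.slide ?_).symm
      rw [form_ve_left, opp_opp, X.vec_apply_k hd, mul_zero]
    · have h3 := X.rel_ve_vec hd (l := opp X.i) (c := τ)
        (A.sigma_le_of_rel (rel_opp X.hi) (A.ν.refl' _) h2) (ne_opp _).symm
        (ne_opp_of_rel hd X.hk X.hi).symm (fun h => X.hij ((opp_eq_iff _ _).1 h))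
      refine (h3.symm.slide ?_).symm
      rw [form_ve_left, opp_opp, X.vec_apply_i hd, mul_zero]
    · exact (X.rel_ve_vec hd (by rw [A.sigma_eq_top (A.ν.symm' X.hj)]; trivial) X.hij.symm X.hjk
        (ne_opp _)).smul_left _
  have h2 := (h.add h').add h1.zero_two_mul
  rw [halfForm_add_self]
  simpa using h2

end Triple

end Setting

end SpNet

/-! ### The half form of a column, non-self-conjugate case -/

namespace SpNet

open IsLocalRing Module

namespace Setting

variable {n : ℕ} {R : Type*} [CommRing R] {A : Setting n R}

namespace Triple

variable {d : Idx n} (X : A.Triple d)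

/-- `y` lies in the column of the net, and the transvections attached to `X.vec` and `y` have the
long part `∑_{j > 0} y_j y_{-j}`. -/
def Good (y : Idx n → R) : Prop := A.InCol d y ∧ A.Rel X.vec y (halfForm y y)

variable {X}

theorem Good.add (hd : ¬ A.ν d (opp d)) {y y' : Idx n → R} (h : X.Good y) (h' : X.Good y') :
    X.Good (y + y') :=
  ⟨h.1.add h'.1, X.rel_vec_halfForm_add hd h.1 h'.1 h.2 h'.2⟩

theorem Good.of_rel {y : Idx n → R} (h : A.InCol d y) (hy : A.Rel X.vec y 0)
    (h0 : ∀ m, y m = 0 ∨ y (opp m) = 0) : X.Good y :=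
  ⟨h, by rwa [halfForm_self_eq_zero h0]⟩

theorem Good.sum (hd : ¬ A.ν d (opp d)) {ι : Type*} (s : Finset ι) {f : ι → Idx n → R}
    (h : ∀ i ∈ s, X.Good (f i)) : X.Good (∑ i ∈ s, f i) := by
  classical
  induction s using Finset.induction_on with
  | empty =>
    refine Good.of_rel (fun l => ?_) (by simpa using A.rel_zero_right _) (by simp)
    rw [Finset.sum_empty]
    exact zero_mem _
  | insert a s ha ih =>
    rw [Finset.sum_insert ha]
    exact Good.add hd (h a (Finset.mem_insert_self _ _))
      (ih fun i hi => h i (Finset.mem_insert_of_mem hi))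

variable (X)

theorem form_vec (P : Idx n → R) :
    form X.vec P = - (sgn R X.k * P X.k) + X.c * sgn R X.i * P X.i
      - X.δ * sgn R X.j * P (opp X.j) := by
  simp only [vec, map_sub, map_smul, LinearMap.sub_apply, LinearMap.smul_apply, form_ve_left,
    sgn_opp, opp_opp, smul_eq_mul]
  ring

theorem apply_k_eq {P : Idx n → R} (h : form X.vec P = 0) :
    P X.k = X.c * sgn R X.i * sgn R X.k * P X.i
      - X.δ * sgn R X.j * sgn R X.k * P (opp X.j) := by
  have hk := sgn_mul_self (R := R) X.k
  rw [form_vec] at h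
  linear_combination (-sgn R X.k) * h - P X.k * hk

/-- Commutator of (vec, e_t) with (w, e_{-t}); the index t is free because `vec` vanishes there. -/
theorem rel_of_rel_opp_t (hd : ¬ A.ν d (opp d)) {w : Idx n → R} (h1 : A.Rel w (ve (opp X.t)) 0)
    (h2 : form X.vec w = 0) (h3 : w (opp X.t) = 0) : A.Rel X.vec w 0 := by
  have ht : A.Rel X.vec (ve X.t) 0 := by
    have := X.rel_ve_vec hd (l := X.t) (c := 1)
      (by rw [A.sigma_eq_top (A.ν.symm' X.ht)]; trivial) X.hti X.htk
      (ne_opp_of_rel hd X.ht X.hj)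
    rwa [one_smul] at this
  have h4 := ht.comm_rel h1 (form_eq_zero_swap h2)
    (by rw [form_ve_left, opp_opp, X.vec_apply_t hd, mul_zero])
    (by rw [form_ve_right, h3, mul_zero, neg_zero])
  rw [form_ve_left, opp_opp, ve_self, mul_one] at h4
  exact h4.of_unit_smul_right (isUnit_sgn _)

/-- P is split into pieces whose half form vanishes; by additivity H contains, up to denominators,
the transvection of (vec, P) with long part halfForm P P. Comparison with the one with long part 0
leaves a purely long transvection along `vec`, which is then moved to a basis vector. -/
theorem halfForm_mem_gamma (hd : ¬ A.ν d (opp d)) {P : Idx n → R} (hP : A.InCol d P)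
    (h : A.Rel X.vec P 0) : halfForm P P ∈ A.net.Γ (opp d) := by
  classical
  have hk := sgn_mul_self (R := R) X.k
  have top : ∀ {m} (c : R), A.ν d m → c ∈ A.net.σ m d := fun c hm => by
    rw [A.sigma_eq_top (A.ν.symm' hm)]; trivial
  have Pj : P (opp X.j) ∈ A.net.σ (opp d) d :=
    A.sigma_le_of_rel (rel_opp (A.ν.symm' X.hj)) (A.ν.refl' _) (hP _)
  set c1 := X.c * sgn R X.i * sgn R X.k
  set δ1 := -(X.δ * sgn R X.j * sgn R X.k)
  -- The coordinates of P at i, k and -j are tied together by B(vec,P) = 0. They are grouped into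
  -- P_i w1 and w2, each orthogonal to `vec`; every other coordinate is a piece of its own.
  set w1 : Idx n → R := ve X.i + c1 • ve X.k
  set w2 : Idx n → R := P (opp X.j) • ve (opp X.j) + (P (opp X.j) * δ1) • ve X.k
  have hkj : X.k ≠ opp X.j := ne_opp_of_rel hd X.hk X.hj
  have hij : X.i ≠ opp X.j := ne_opp_of_rel hd X.hi X.hj
  have hPk := X.apply_k_eq h.1
  have hw1 : A.Supp d w1 := (Supp.ve X.hi).add ((Supp.ve X.hk).smul _)
  have g1 : X.Good (P X.i • w1) := by
    refine Good.of_rel ?_ (Rel.smul_right ?_ _) fun m => ?_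
    · refine InCol.smul _ (InCol.add ?_ (InCol.smul_ve (top _ X.hk)))
      have := InCol.smul_ve (A := A) (top 1 X.hi)
      rwa [one_smul] at this
    · refine X.rel_of_rel_opp_t hd ?_ ?_ ?_
      · refine (rel_ve_supp hd X.ht hw1 ?_).symm
        simp [w1, ve_of_ne X.hti, ve_of_ne X.htk]
      · rw [form_vec]
        simp [w1, ve_of_ne X.hik, ve_of_ne X.hik.symm, ve_of_ne hij.symm, ve_of_ne hkj.symm, c1]
        linear_combination (-(X.c * sgn R X.i)) * hk
      · exact hw1.apply_opp_eq_zero hd X.ht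
    · by_cases hm : A.ν d m
      · right; simp [hw1.apply_opp_eq_zero hd hm]
      · left; simp [hw1 m hm]
  have g2 : X.Good w2 := by
    refine Good.of_rel ?_ ?_ fun m => ?_
    · exact InCol.add (InCol.smul_ve (hP _)) (InCol.smul_ve (top _ X.hk))
    · refine X.rel_of_rel_opp_t hd ?_ ?_ ?_
      · refine Rel.symm (Rel.add_zero_zero ?_ ?_ ?_)
        · refine (A.rel_ve (ne_opp_of_rel hd X.ht X.hj).symm ?_).symm
          exact A.sigma_le_of_rel (rel_opp X.hj) X.ht Pj
        · exact (rel_ve_opp X.hk X.ht X.htk.symm).symm.smul_right _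
        · simp only [map_smul, LinearMap.smul_apply]
          rw [form_ve_ve (by rw [opp_opp]; exact X.hjk)]
          simp
      · rw [form_vec]
        simp [w2, ve_of_ne X.hik, ve_of_ne hij, ve_of_ne hkj, ve_of_ne hkj.symm, δ1]
        linear_combination (P (opp X.j) * X.δ * sgn R X.j) * hk
      · have e1 : opp X.t ≠ opp X.j := fun h => X.htj ((opp_eq_iff _ _).1 h)
        simp [w2, ve_of_ne e1, ve_of_ne (ne_opp_of_rel hd X.hk X.ht).symm]
    · by_cases hmk : m = X.k
      · right
        have e1 : opp X.k ≠ opp X.j := fun h => X.hjk ((opp_eq_iff _ _).1 h).symm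
        simp [w2, hmk, ve_of_ne e1, ve_of_ne (ne_opp X.k).symm]
      by_cases hmj : m = opp X.j
      · right
        simp [w2, hmj, ve_of_ne X.hjk, ve_of_ne (ne_opp X.j)]
      · left
        simp [w2, ve_of_ne hmk, ve_of_ne hmj]
  have g3 : X.Good (∑ l, (if l = X.i ∨ l = X.k ∨ l = opp X.j then 0 else P l) • ve l) := by
    refine Good.sum hd _ fun l _ => ?_
    split_ifs with hl
    · rw [zero_smul]
      exact Good.of_rel (fun l => zero_mem _) (A.rel_zero_right _) (by simp)
    · simp only [not_or] at hl
      refine Good.of_rel (InCol.smul_ve (hP l)) (X.rel_ve_vec hd (hP l) hl.1 hl.2.1 hl.2.2)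
        fun m => ?_
      by_cases hm : m = l
      · right; simp [ve_of_ne (hm ▸ (ne_opp m).symm : opp m ≠ l)]
      · left; simp [ve_of_ne hm]
  have hsum : P = P X.i • w1 + w2 +
      ∑ l, (if l = X.i ∨ l = X.k ∨ l = opp X.j then 0 else P l) • ve l := by
    rw [sum_smul_ve]
    ext l
    by_cases hli : l = X.i
    · subst hli
      simp [w1, w2, ve_of_ne X.hik, ve_of_ne hij]
    by_cases hlk : l = X.k
    · subst hlk
      simp [w1, w2, ve_of_ne X.hik.symm, ve_of_ne hkj, c1, δ1]
      linear_combination hPk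
    by_cases hlj : l = opp X.j
    · subst hlj
      simp [w1, w2, ve_of_ne hij.symm, ve_of_ne hkj.symm]
    simp [w1, w2, ve_of_ne hli, ve_of_ne hlk, ve_of_ne hlj, hli, hlk, hlj]
  have g : X.Good P := by
    rw [hsum]
    exact Good.add hd (Good.add hd g1 g2) g3
  have h1 : A.Rel X.vec 0 (halfForm P P) := by
    simpa using g.2.add h.neg
  have hγ := hP.halfForm_mem hP
  set γ := halfForm P P
  have hν : A.ν (opp X.t) (opp X.k) := rel_opp (A.ν.trans' (A.ν.symm' X.ht) X.hk)
  have htk : opp X.t ≠ opp X.k := fun h => X.htk ((opp_eq_iff _ _).1 h)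
  -- This g sends `vec` to vec + e_{-t}. Comparing the long transvections along both vectors yields
  -- one along e_{-t}.
  obtain ⟨g, hg, hgv⟩ := A.exists_short htk
    (by rw [opp_opp]; exact (ne_opp_of_rel hd X.hk X.ht).symm) hν
  have h2 := h1.conj hg
  rw [hgv, map_zero, X.vec_apply_opp_k hd, opp_opp, X.vec_apply_t hd, mul_zero, zero_smul,
    sub_zero, one_smul] at h2
  have h3 : A.Rel X.vec (γ • ve (opp X.t)) 0 :=
    X.rel_ve_vec hd (A.sigma_le_of_rel (rel_opp X.ht) (A.ν.refl' _) hγ)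
      (ne_opp_of_rel hd X.hi X.ht).symm (ne_opp_of_rel hd X.hk X.ht).symm
      (fun h => X.htj ((opp_eq_iff _ _).1 h))
  have h4 := h1.of_add (by rw [form_ve_right, opp_opp, X.vec_apply_t hd, mul_zero, neg_zero]) h2 h3
  exact A.gamma_le_of_rel (rel_opp (A.ν.symm' X.ht)) (A.mem_gamma_of_rel h4)

end Triple

end Setting

end SpNet

/-! ### Columns of b belonging to a non-self-conjugate class -/

namespace SpNet

open IsLocalRing Module

namespace Setting

variable {n : ℕ} {R : Type*} [CommRing R] {A : Setting n R} [IsLocalRing R]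

theorem form_mem_sigma_of_rel {d : Idx n} (hd : ¬ A.ν d (opp d)) {P Q x' : Idx n → R}
    (h : A.Rel P Q 0) (hP : A.pr d P ≠ 0) (hQ : A.pr (opp d) Q ≠ 0) (hx' : A.Supp (opp d) x')
    (hPx' : form P x' = 0) : form Q x' ∈ A.net.σ d (opp d) := by
  obtain ⟨l, hl, g, hg, hgt⟩ := h.exists_isTrans
  refine form_mem_sigma hd hg hgt ?_ hQ hx' (by simp [hPx'])
  rw [A.pr_smul]
  exact smul_ne_zero ((residue_ne_zero_iff_isUnit _).2 hl) hP

theorem pr_act_of_near {b : Sp n R} {p q z : Idx n → R} (hb : IsTrans b p q 0)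
    (hp : residue R (form p z) = 0) (hq : residue R (form q z) = 0) (e : Idx n) :
    A.pr e (act b z) = A.pr e z := by
  rw [hb, zero_mul, zero_smul, add_zero, A.pr_add, A.pr_add, A.pr_smul, A.pr_smul, hp, hq]
  simp

theorem pr_ne_zero_of_pr_act {b : Sp n R} {p q y : Idx n → R} (hb : IsTrans b p q 0) {d e : Idx n}
    (hy : A.Supp d y) (h : A.pr e (act b y) ≠ 0) : A.pr d y ≠ 0 := by
  intro h0
  have h1 : ∀ i, residue R (y i) = 0 := fun i => by
    by_cases hi : A.ν d i
    · exact congrFun h0 ⟨i, hi⟩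
    · rw [hy i hi, map_zero]
  have h2 : ∀ v, residue R (form v y) = 0 := fun v => by
    rw [form_apply, map_sum]
    simp [h1]
  refine h ?_
  rw [pr_act_of_near hb (h2 p) (h2 q)]
  ext i
  exact h1 i

/-- For z on -d orthogonal to y and fixed by b modulo the maximal ideal, the conjugated pair (by,
bz) and `form_mem_sigma` settle all x orthogonal to bz. Two such z with independent images make
every x a sum of two admissible vectors. -/
theorem form_act_mem_sigma {b : Sp n R} {p q : Idx n → R} (hb : b ∈ A.H) (hbt : IsTrans b p q 0)
    {d : Idx n} (hd : ¬ A.ν d (opp d)) {y x : Idx n → R} (hy : A.Supp d y)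
    (hP : A.pr d (act b y) ≠ 0) (hx : A.Supp d x) :
    form (act b y) x ∈ A.net.σ (opp d) d := by
  have hy0 := pr_ne_zero_of_pr_act hbt hy hP
  have step : ∀ z, A.Supp (opp d) z → form y z = 0 → residue R (form p z) = 0 →
      residue R (form q z) = 0 → A.pr (opp d) z ≠ 0 → ∀ x, A.Supp d x → form (act b z) x = 0 →
      form (act b y) x ∈ A.net.σ (opp d) d := by
    intro z hz hyz hpz hqz hz0 x hx hzx
    have h1 := (rel_of_pr hd hy hz hyz hy0).conj hb
    have h2 := form_mem_sigma_of_rel (d := opp d) (A.not_self_opp hd) h1.symm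
      (by rwa [pr_act_of_near hbt hpz hqz]) (by rwa [opp_opp]) hx.to_opp_opp hzx
    rwa [opp_opp] at h2
  obtain ⟨z, hz, hzy, hzn, hz0⟩ := A.exists_form_eq_zero_notMem hd (A.indep_one hy0) ![p, q] ![]
    (by norm_num)
  obtain ⟨z', hz', hzy', hzn', hz0'⟩ := A.exists_form_eq_zero_notMem hd (A.indep_one hy0) ![p, q]
    ![z] (by norm_num)
  have e1 := pr_act_of_near (A := A) hbt (hzn 0) (hzn 1) (opp d)
  have e2 := pr_act_of_near (A := A) hbt (hzn' 0) (hzn' 1) (opp d)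
  have hind : A.Indep (opp d) ![act b z', act b z] := by
    refine A.indep_cons (A.indep_one ?_) ?_
    · rw [e1]; exact pr_ne_zero_of_notMem hz0
    · rw [e2]
      refine fun hc => hz0' (prSpan_le A (y := ![z]) (fun a => ?_) hc)
      fin_cases a
      change A.pr (opp d) (act b z) ∈ _
      rw [e1]
      exact A.pr_mem_prSpan (opp d) ![z] 0
  obtain ⟨x₁, hx₁, hf⟩ := A.exists_form_eq_opp hind ![form (act b z') x, 0]
  have f1 : form (act b z') x₁ = form (act b z') x := hf 0
  have f2 : form (act b z) x₁ = 0 := hf 1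
  rw [show x = x₁ + (x - x₁) by abel, map_add]
  refine add_mem ?_ ?_
  · exact step z hz (hzy 0) (hzn 0) (hzn 1) (pr_ne_zero_of_notMem hz0) x₁ hx₁ f2
  · exact step z' hz' (hzy' 0) (hzn' 0) (hzn' 1) (pr_ne_zero_of_notMem hz0') _ (hx.sub hx₁)
      (by rw [map_sub, f1, sub_self])

theorem act_apply_opp_mem_sigma {b : Sp n R} {p q : Idx n → R} (hb : b ∈ A.H)
    (hbt : IsTrans b p q 0) {d i : Idx n} (hd : ¬ A.ν d (opp d)) {y : Idx n → R} (hy : A.Supp d y)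
    (hP : A.pr d (act b y) ≠ 0) (hi : A.ν d i) : act b y (opp i) ∈ A.net.σ (opp d) d := by
  have h := form_act_mem_sigma hb hbt hd hy hP (Supp.ve hi)
  rw [form_ve_right, neg_mem_iff] at h
  exact (Ideal.unit_mul_mem_iff_mem _ (isUnit_sgn i)).1 h

/-- With Q = bz for suitable z, the sparse vector is made orthogonal to both P and Q, so the
transvection (P,Q) fixes it. This transvection moves an auxiliary x orthogonal to P by a unit
multiple of P, and the commutator turns (vec,x) into (vec,P). -/
theorem exists_rel_vec {b : Sp n R} {p q : Idx n → R} (hb : b ∈ A.H)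
    (hbt : IsTrans b p q 0) {d : Idx n} (hd : ¬ A.ν d (opp d)) {y : Idx n → R} (hy : A.Supp d y)
    (hP : A.pr d (act b y) ≠ 0) : ∃ X : A.Triple d, A.Rel X.vec (act b y) 0 := by
  have hd' := A.not_self_opp hd
  have hy0 := pr_ne_zero_of_pr_act hbt hy hP
  obtain ⟨i, hi, hPi⟩ := A.exists_isUnit_of_pr_ne_zero hP
  obtain ⟨z, hz, hzy, hzn, hz0⟩ := A.exists_form_eq_zero_notMem hd (A.indep_one hy0) ![p, q]
    ![ve (opp i)] (by norm_num)
  have hpr := pr_act_of_near (A := A) hbt (hzn 0) (hzn 1)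
  -- Otherwise z, which agrees with bz modulo the maximal ideal on -d, would reduce to a multiple of
  -- e_{-i}.
  obtain ⟨j, hj, hij, hzj⟩ : ∃ j, A.ν d j ∧ i ≠ j ∧ IsUnit (act b z (opp j)) := by
    by_contra! hc
    refine hz0 ?_
    have h1 : A.pr (opp d) z = residue R (z (opp i)) • A.pr (opp d) (ve (opp i)) := by
      ext ⟨m, hm⟩
      have hm' : A.ν d (opp m) := by simpa [opp_opp] using A.hν _ _ hm
      by_cases hmi : m = opp i
      · subst hmi; simp [pr]
      · have h2 := hc (opp m) hm' (fun h => hmi (by rw [h, opp_opp]))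
        rw [opp_opp] at h2
        have h3 : residue R (act b z m) = 0 := by
          by_contra h3
          exact h2 ((residue_ne_zero_iff_isUnit _).1 h3)
        have h4 := congrFun (hpr (opp d)) ⟨m, hm⟩
        simp only [pr] at h4
        simp [pr, ve_of_ne hmi, ← h4, h3]
    rw [h1]
    exact Submodule.smul_mem _ _ (A.pr_mem_prSpan (opp d) ![ve (opp i)] 0)
  obtain ⟨k, hk, hkn⟩ := A.exists_rel_of_not_self hd {i, j}
    (Finset.card_le_two.trans_lt (by norm_num))
  obtain ⟨t, ht, htn⟩ := A.exists_rel_of_not_self hd {i, j, k}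
    (Finset.card_le_three.trans_lt (by norm_num))
  simp only [Finset.mem_insert, Finset.mem_singleton, not_or] at hkn htn
  have hrel := (rel_of_pr hd hy hz (hzy 0) hy0).conj hb
  have hQz : A.pr (opp d) (act b z) ≠ 0 := by
    rw [hpr]; exact pr_ne_zero_of_notMem hz0
  have hQd : ∀ m, A.ν d m → act b z m ∈ A.net.σ d (opp d) := fun m hm => by
    have h := act_apply_opp_mem_sigma hb hbt hd' hz hQz (rel_opp hm)
    rwa [opp_opp, opp_opp] at h
  have hPd := fun m hm => act_apply_opp_mem_sigma hb hbt hd hy hP (i := m) hm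
  have hQi : residue R (act b z i) = 0 := by
    have h1 := hpr d
    rw [pr_of_supp A (fun h => hd h) hz] at h1
    exact congrFun h1 ⟨i, hi⟩
  set P := act b y
  set Q := act b z
  obtain ⟨u, hu⟩ := hzj.exists_right_inv
  -- Up to a unit this is the determinant of the system B(vec,P) = B(vec,Q) = 0 in c and δ. It is
  -- invertible because P_i is a unit while Q_i lies in the maximal ideal, z having no component on
  -- d. Solving for δ first gives the formulas below.
  obtain ⟨w, hw⟩ : ∃ w, (P i - u * P (opp j) * Q i) * w = 1 := by
    refine IsUnit.exists_right_inv ((residue_ne_zero_iff_isUnit _).1 ?_)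
    rw [map_sub, map_mul, hQi, mul_zero, sub_zero]
    exact (residue_ne_zero_iff_isUnit _).2 hPi
  have si := sgn_mul_self (R := R) i
  have sj := sgn_mul_self (R := R) j
  have sk := sgn_mul_self (R := R) k
  set c := sgn R i * sgn R k * w * (P k - u * P (opp j) * Q k)
  set δ := sgn R j * u * (c * sgn R i * Q i - sgn R k * Q k)
  have hδ : δ ∈ A.net.σ d (opp d) :=
    Ideal.mul_mem_left _ _ (sub_mem (Ideal.mul_mem_left _ _ (hQd i hi))
      (Ideal.mul_mem_left _ _ (hQd k hk)))
  let X : A.Triple d := ⟨i, j, k, t, hi, hj, hk, ht, hij, Ne.symm hkn.1, Ne.symm hkn.2, htn.1,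
    htn.2.1, htn.2.2, c, δ, hδ⟩
  refine ⟨X, ?_⟩
  have hcw : c * sgn R i * (P i - u * P (opp j) * Q i) = sgn R k * (P k - u * P (opp j) * Q k) := by
    simp only [c]
    linear_combination (sgn R k * (P k - u * P (opp j) * Q k)) * hw +
      (sgn R k * (P k - u * P (opp j) * Q k) * w * (P i - u * P (opp j) * Q i)) * si
  have fQ : form X.vec Q = 0 := by
    rw [X.form_vec]
    simp only [X, δ]
    linear_combination (-(u * Q (opp j) * (c * sgn R i * Q i - sgn R k * Q k))) * sj
      - (c * sgn R i * Q i - sgn R k * Q k) * hu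
  have fP : form X.vec P = 0 := by
    rw [X.form_vec]
    simp only [X, δ]
    linear_combination (-(u * P (opp j) * (c * sgn R i * Q i - sgn R k * Q k))) * sj + hcw
  obtain ⟨v, hv⟩ := hPi.exists_right_inv
  set ε := -(sgn R i * sgn R j * P (opp j) * v)
  have hε : ε ∈ A.net.σ (opp d) d :=
    neg_mem (Ideal.mul_mem_right _ _ (Ideal.mul_mem_left _ _ (hPd j hj)))
  -- ε is chosen so that B(P,x) = 0. Modulo the maximal ideal B(Q,x) reduces to ±Q_{-j}, a unit.
  set x : Idx n → R := ve j + (-ε) • ve (opp i)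
  have fPx : form P x = 0 := by
    simp only [x, map_add, map_smul, form_ve_right, opp_opp, sgn_opp, smul_eq_mul, ε]
    linear_combination (sgn R j * P (opp j) * P i * v) * si + (sgn R j * P (opp j)) * hv
  have fQx : IsUnit (form Q x) := by
    rw [← residue_ne_zero_iff_isUnit]
    simp only [x, map_add, map_smul, form_ve_right, opp_opp, sgn_opp, smul_eq_mul, map_mul,
      map_neg, hQi, mul_zero, neg_zero, add_zero]
    rw [neg_ne_zero, ← map_mul, residue_ne_zero_iff_isUnit]
    exact (isUnit_sgn j).mul hzj
  have hX : A.Rel X.vec x 0 := by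
    refine Rel.add_zero_zero ?_ ?_ ?_
    · have := X.rel_ve_vec hd (l := j) (c := 1) (by rw [A.sigma_eq_top (A.ν.symm' hj)]; trivial)
        hij.symm (Ne.symm hkn.2) (ne_opp j)
      rwa [one_smul] at this
    · refine X.rel_ve_vec hd (neg_mem ?_) (ne_opp_of_rel hd hi hi).symm
        (ne_opp_of_rel hd hk hi).symm (fun h => hij ((opp_eq_iff _ _).1 h))
      exact A.sigma_le_of_rel (rel_opp hi) (A.ν.refl' _) hε
    · rw [map_smul, form_ve_ve (fun h => hij ((opp_eq_iff _ _).1 h).symm), smul_zero]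
  clear_value x
  obtain ⟨l, hl, g, hg, hgt⟩ := hrel.exists_isTrans
  have hgX : act g X.vec = X.vec := by
    rw [hgt]
    simp [form_eq_zero_swap fP, form_eq_zero_swap fQ]
  have h1 := hX.comm hg hgX
  have hgx : act g x = (form Q x * l) • P + x := by
    rw [hgt]
    simp only [map_smul, LinearMap.smul_apply, fPx, smul_zero, zero_smul, mul_zero, add_zero,
      smul_smul]
    module
  rw [hgx, add_sub_cancel_right, map_add, LinearMap.add_apply, map_smul, LinearMap.smul_apply, fPx,
    form_self, smul_zero, add_zero, neg_zero] at h1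
  exact h1.of_unit_smul_right (fQx.mul hl)

theorem inCol_act_of_generic {b : Sp n R} {p q : Idx n → R} (hb : b ∈ A.H)
    (hbt : IsTrans b p q 0) {d : Idx n} (hd : ¬ A.ν d (opp d)) {y : Idx n → R} (hy : A.Supp d y)
    (hP : A.pr d (act b y) ≠ 0) :
    A.InCol d (act b y) ∧ halfForm (act b y) (act b y) ∈ A.net.Γ (opp d) := by
  obtain ⟨X, hX⟩ := exists_rel_vec hb hbt hd hy hP
  have h : A.InCol d (act b y) := fun l => by
    by_cases h1 : A.ν d l
    · rw [A.sigma_eq_top (A.ν.symm' h1)]; trivial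
    by_cases h2 : A.ν (opp d) l
    · have h3 := act_apply_opp_mem_sigma hb hbt hd hy hP (i := opp l)
        (by simpa [opp_opp] using A.hν _ _ h2)
      rw [opp_opp] at h3
      exact A.sigma_le_of_rel h2 (A.ν.refl' _) h3
    · exact X.mem_sigma hd hX h1 h2
  exact ⟨h, X.halfForm_mem_gamma hd h hX⟩

/-- If by vanishes on d modulo the maximal ideal, add a y₀ for which it does not. The half form is
additive up to form (act b y) (act b y₀), which is zero, and twice an element of σ_{-d,d}, which
lies in Γ. -/
theorem inCol_act {b : Sp n R} {p q : Idx n → R} (hb : b ∈ A.H)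
    (hbt : IsTrans b p q 0) {d : Idx n} (hd : ¬ A.ν d (opp d)) {y : Idx n → R} (hy : A.Supp d y) :
    A.InCol d (act b y) ∧ halfForm (act b y) (act b y) ∈ A.net.Γ (opp d) := by
  by_cases hP : A.pr d (act b y) = 0
  · obtain ⟨y₀, hy₀, -, hn, h0⟩ := A.exists_form_eq_zero_notMem_opp hd A.indep_empty ![p, q] ![]
      (by norm_num)
    have e0 : A.pr d (act b y₀) ≠ 0 := by
      rw [pr_act_of_near hbt (hn 0) (hn 1)]
      exact pr_ne_zero_of_notMem h0
    obtain ⟨h1, h2⟩ := inCol_act_of_generic hb hbt hd hy₀ e0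
    obtain ⟨h3, h4⟩ := inCol_act_of_generic hb hbt hd (hy.add hy₀) (by
      rw [map_add, A.pr_add, hP, zero_add]; exact e0)
    rw [map_add] at h3 h4
    have h5 : A.InCol d (act b y) := by
      have := h3.sub h1
      rwa [add_sub_cancel_right] at this
    refine ⟨h5, ?_⟩
    rw [halfForm_add_self, form_act, Supp.form_eq_zero hd hy hy₀, add_zero] at h4
    have h6 := sub_mem (sub_mem h4 (h1.two_mul_halfForm_mem h5)) h2
    convert h6 using 1
    ring
  · exact inCol_act_of_generic hb hbt hd hy hP

end Setting

end SpNet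

/-! ### Columns of b belonging to a self-conjugate class -/

namespace SpNet

open IsLocalRing Module

namespace Setting

variable {n : ℕ} {R : Type*} [CommRing R] {A : Setting n R} [IsLocalRing R]

/-- The conjugated long transvection along P fixes x = e_j + c e_{-m}, chosen orthogonal to P, and
moves e_{-m} by a unit multiple of P. The commutator attaches P to x, and both sides are then cut
down to basis vectors. -/
theorem mem_sigma_of_self {b g : Sp n R} {y : Idx n → R} {α : R} (hb : b ∈ A.H) (hg : g ∈ A.H)
    (hgt : IsTrans g y 0 α) (hα : IsUnit α) {i : Idx n} (hi : A.ν i (opp i))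
    (hP : A.pr i (act b y) ≠ 0) {l : Idx n} (hl : ¬ A.ν i l) : act b y l ∈ A.net.σ l i := by
  obtain ⟨m, hm, hPm⟩ := A.exists_isUnit_of_pr_ne_zero hP
  have hh := mul_mem (mul_mem hb hg) (inv_mem hb)
  have hht := hgt.conj b
  set P := act b y
  have self : ∀ {j}, A.ν i j → A.ν i (opp j) := fun hj => A.ν.trans' hi (rel_opp hj)
  have hself : ∀ {j}, A.ν i j → A.ν j (opp j) := fun hj => A.ν.trans' (A.ν.symm' hj) (self hj)
  have top : ∀ {j k} (c : R), A.ν i j → A.ν i k → c ∈ A.net.σ j k := fun c hj hk => by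
    rw [A.sigma_eq_top (A.ν.trans' (A.ν.symm' hj) hk)]; trivial
  obtain ⟨j, hmj, hjm, hjm'⟩ := A.exists_rel_of_self (hself hm)
  have hj := A.ν.trans' hm hmj
  obtain ⟨k, hjk, hkj, hkj'⟩ := A.exists_rel_of_self (hself hj)
  have hk := A.ν.trans' hj hjk
  obtain ⟨v, hv⟩ := hPm.exists_right_inv
  have sm := sgn_mul_self (R := R) m
  set c := sgn R m * sgn R j * P (opp j) * v
  set x : Idx n → R := ve j + c • ve (opp m)
  have fPx : form P x = 0 := by
    simp only [x, map_add, map_smul, form_ve_right, opp_opp, sgn_opp, smul_eq_mul, c]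
    linear_combination (sgn R j * P (opp j) * v * P m) * sm + (sgn R j * P (opp j)) * hv
  have h1 : A.Rel x (ve (opp m)) 0 := by
    refine (Rel.add_zero_zero (rel_ve_opp hj hm hjm).symm
      (A.rel_ve (ne_opp m).symm (top c (self hm) hm)).symm ?_).symm
    rw [map_smul, form_ve_ve (fun h => hjm ((opp_eq_iff _ _).1 h)), smul_zero]
  have h2 := h1.comm hh (by rw [hht]; simp [fPx])
  have h3 : act (b * g * b⁻¹) (ve (opp m)) - ve (opp m) = (α * (sgn R m * P m)) • P := by
    rw [hht]
    simp [sgn_opp]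
  rw [h3] at h2
  have hu : IsUnit (α * (sgn R m * P m)) := hα.mul ((isUnit_sgn m).mul hPm)
  have hx : ∀ a, ¬ A.ν i a → x a = 0 := fun a ha => by
    have e1 : a ≠ j := by rintro rfl; exact ha hj
    have e2 : a ≠ opp m := by rintro rfl; exact ha (self hm)
    simp [x, ve_of_ne e1, ve_of_ne e2]
  obtain ⟨m', hm', h4⟩ := h2.extract (l := l)
    (fun a ha => hx a fun hc => hl (A.ν.trans' hc (A.ν.symm' ha)))
    (fun a ha => hx a fun hc => hl (by
      have := self (A.ν.trans' hc (A.ν.symm' ha))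
      rwa [opp_opp] at this))
  have hm'i : ∀ {a}, A.ν i a → a ≠ m' := by
    rintro a ha rfl
    exact hl (A.ν.trans' ha (A.ν.symm' hm'))
  -- The coordinate x_j = 1 is moved to e_{-j} and then, by a short commutator that also removes the
  -- long part, to e_k.
  have h5 := h4.symm.long (s := opp j) (rel_opp (hself hj))
    (by rw [opp_opp, Pi.smul_apply, ve_of_ne (hm'i hj), smul_zero])
  have hxj : x j = 1 := by simp [x, ve_of_ne hjm']
  rw [opp_opp, hxj, one_smul] at h5
  have h6 := h5.short_single (s := k) (r := opp j)
    (A.ν.trans' (A.ν.symm' hjk) (hself hj)) hkj' (by rwa [opp_opp])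
    (by rw [Pi.smul_apply, ve_of_ne (hm'i (self hj)), smul_zero])
    (by rw [Pi.smul_apply, ve_of_ne (hm'i (self hk)), smul_zero])
    (ve_of_ne fun h => hkj ((opp_eq_iff _ _).1 h))
  rw [ve_self, one_smul, ← opp_opp k] at h6
  have h7 := A.mem_sigma_of_rel (hm'i (self hk)).symm (by rw [opp_opp]; exact (hm'i hk).symm) h6
  have h8 := A.sigma_le_of_rel (A.ν.symm' hm') (A.ν.symm' (self hk)) h7
  exact (Ideal.unit_mul_mem_iff_mem _ hu).1 h8

/-- The class has more than two elements, so it supports a vector, nonzero modulo the maximal ideal,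
that is orthogonal to p and q there. Such a vector is fixed by b modulo that ideal, so the columns
of the class cannot all vanish on it. -/
theorem exists_pr_act_ve_ne_zero {b : Sp n R} {p q : Idx n → R} (hbt : IsTrans b p q 0)
    {i : Idx n} (hi : A.ν i (opp i)) : ∃ j, A.ν i j ∧ A.pr i (act b (ve j)) ≠ 0 := by
  classical
  by_contra! hc
  obtain ⟨k, hk, hki, hki'⟩ := A.exists_rel_of_self hi
  have hcard : 2 < Fintype.card {j // A.ν i j} := by
    rw [Fintype.two_lt_card_iff]
    refine ⟨⟨i, A.ν.refl' i⟩, ⟨opp i, hi⟩, ⟨k, hk⟩, ?_, ?_, ?_⟩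
    · exact fun h => ne_opp i (congrArg Subtype.val h)
    · exact fun h => hki (congrArg Subtype.val h).symm
    · exact fun h => hki' (congrArg Subtype.val h).symm
  obtain ⟨u, -, hu, hu0⟩ := exists_solution_notMem (R := R) (ι := {j // A.ν i j}) (k := 0)
    (fun a => a.elim0) linearIndependent_empty_type
    (fun (a : Fin 2) j => form (![p, q] a) (ve j.1)) ⊥ (by simpa using hcard)
  set y : Idx n → R := ∑ j, u j • ve j.1
  have hf : ∀ a : Fin 2, residue R (form (![p, q] a) y) = 0 := fun a => by
    rw [← hu a]
    simp [y, dotProduct, mul_comm]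
  have h1 : A.pr i (act b y) = 0 := by
    ext m
    simp only [pr, y, map_sum, map_smul, Finset.sum_apply, Pi.smul_apply, smul_eq_mul, map_mul]
    refine Finset.sum_eq_zero fun j _ => ?_
    have := congrFun (hc j.1 j.2) m
    simp only [pr] at this
    rw [this]
    simp
  rw [pr_act_of_near hbt (hf 0) (hf 1)] at h1
  refine hu0 ?_
  rw [Submodule.mem_bot, ← h1]
  ext m
  simp only [pr, y, Finset.sum_apply, Pi.smul_apply, smul_eq_mul]
  rw [Finset.sum_eq_single m]
  · simp
  · intro j _ hjm
    rw [ve_of_ne fun h => hjm (Subtype.ext h.symm), mul_zero]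
  · simp

theorem inCol_act_ve_of_self {b : Sp n R} {p q : Idx n → R} (hb : b ∈ A.H)
    (hbt : IsTrans b p q 0) {i : Idx n} (hi : A.ν i (opp i)) : A.InCol i (act b (ve i)) := by
  intro l
  by_cases hl : A.ν i l
  · rw [A.sigma_eq_top (A.ν.symm' hl)]; trivial
  have long : ∀ j, A.ν i j → ∃ g ∈ A.H, IsTrans g (ve j) 0 (sgn R j) := fun j hj => by
    obtain ⟨g, hg, hgv⟩ := A.exists_long (s := j)
      (A.ν.trans' (A.ν.symm' hj) (A.ν.trans' hi (rel_opp hj)))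
    have sj := sgn_mul_self (R := R) j
    refine ⟨g, hg, fun v => ?_⟩
    rw [hgv, form_ve_left, ← mul_assoc, sj]
    simp
  by_cases h0 : A.pr i (act b (ve i)) = 0
  · obtain ⟨j, hj, hj0⟩ := exists_pr_act_ve_ne_zero hbt hi
    have hji : j ≠ i := by rintro rfl; exact hj0 h0
    -- If be_i is degenerate, then be_j and b(e_i + e_j) are not, and they differ by be_i. The long
    -- transvection along e_i + e_j is a conjugate by g' of the one along e_i.
    obtain ⟨g', hg', hg'v⟩ : ∃ g ∈ A.H, act g (ve i) = ve i + ve j := by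
      by_cases hji' : j = opp i
      · obtain ⟨g, hg, hgv⟩ := A.exists_long (s := opp i) (rel_opp hi)
        exact ⟨g, hg, by rw [hgv, opp_opp, ve_self, one_smul, hji']⟩
      · obtain ⟨g, hg, hgv⟩ := A.exists_short hji hji' (A.ν.symm' hj)
        refine ⟨g, hg, ?_⟩
        rw [hgv, ve_self, ve_of_ne fun h => hji' (by rw [← h, opp_opp])]
        simp
    obtain ⟨g, hg, hgt⟩ := long j hj
    have h1 := mem_sigma_of_self hb hg hgt (isUnit_sgn j) hi hj0 hl
    obtain ⟨g, hg, hgt⟩ := long i (A.ν.refl' i)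
    have h2 := hgt.conj g'
    rw [hg'v, map_zero] at h2
    have h3 := mem_sigma_of_self hb (mul_mem (mul_mem hg' hg) (inv_mem hg')) h2 (isUnit_sgn i) hi
      (by rwa [map_add, A.pr_add, h0, zero_add]) hl
    rw [map_add] at h3
    exact (Ideal.add_mem_iff_left _ h1).1 h3
  · obtain ⟨g, hg, hgt⟩ := long i (A.ν.refl' i)
    exact mem_sigma_of_self hb hg hgt (isUnit_sgn i) hi h0 hl

theorem inCol_act_ve {b : Sp n R} {p q : Idx n → R} (hb : b ∈ A.H) (hbt : IsTrans b p q 0)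
    (i : Idx n) : A.InCol i (act b (ve i)) ∧
      halfForm (act b (ve i)) (act b (ve i)) ∈ A.net.Γ (opp i) := by
  by_cases hi : A.ν i (opp i)
  · refine ⟨inCol_act_ve_of_self hb hbt hi, ?_⟩
    rw [A.gamma_eq_top (rel_opp hi)]
    trivial
  · exact inCol_act hb hbt hi (Supp.ve (A.ν.refl' i))

end Setting

/-! ### The form net subgroup is closed under products -/

namespace FormNet

variable {n : ℕ} {R : Type*} [CommRing R] (N : FormNet n R)

theorem act_inv_ve_apply (g : Sp n R) (k m : Idx n) :
    act g⁻¹ (ve m) k = sgn R k * sgn R m * (g : Matrix (Idx n) (Idx n) R) (opp m) (opp k) := by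
  have h := form_act_left g (ve (opp k)) (ve m)
  have sk := sgn_mul_self (R := R) k
  rw [form_ve_right, form_ve_left, opp_opp, sgn_opp, act_ve] at h
  linear_combination (-(act g⁻¹ (ve m) k)) * sk + sgn R k * h

theorem rowLength_eq (g : Sp n R) (i : Idx n) :
    rowLength g i = sgn R i * halfForm (act g⁻¹ (ve (opp i))) (act g⁻¹ (ve (opp i))) := by
  have si := sgn_mul_self (R := R) i
  rw [rowLength, halfForm_apply, Finset.mul_sum]
  refine Finset.sum_congr rfl fun j _ => ?_
  have h1 : act g⁻¹ (ve (opp i)) (Sum.inr j) =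
      sgn R i * (g : Matrix (Idx n) (Idx n) R) i (Sum.inl j) := by
    rw [act_inv_ve_apply, opp_opp, sgn_opp]
    simp [sgn]
  rw [h1, ← act_ve g⁻¹]
  linear_combination (-((g : Matrix (Idx n) (Idx n) R) i (Sum.inl j) *
    act g⁻¹ (ve (opp i)) (Sum.inl j))) * si

theorem mem_netSubgroup_iff (g : Sp n R) :
    g ∈ N.netSubgroup ↔ (∀ i j, (g : Matrix (Idx n) (Idx n) R) i j ∈ N.σ i j) ∧
      ∀ i, halfForm (act g⁻¹ (ve (opp i))) (act g⁻¹ (ve (opp i))) ∈ N.Γ i := by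
  have e : ∀ i, rowLength g i ∈ N.Γ i ↔
      halfForm (act g⁻¹ (ve (opp i))) (act g⁻¹ (ve (opp i))) ∈ N.Γ i := fun i => by
    rw [rowLength_eq]
    rcases i with i | i <;> simp [sgn]
  simp only [← e]
  rfl

theorem act_inv_apply_mem {g : Sp n R}
    (h : ∀ i j, (g : Matrix (Idx n) (Idx n) R) i j ∈ N.σ i j) (k m : Idx n) :
    act g⁻¹ (ve m) k ∈ N.σ k m := by
  rw [act_inv_ve_apply, N.unitary k m]
  exact Ideal.mul_mem_left _ _ (h _ _)

theorem halfForm_mem {v w : Idx n → R} {k m : Idx n} (hv : ∀ l, v l ∈ N.σ l k)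
    (hw : ∀ l, w l ∈ N.σ l m) : halfForm v w ∈ N.σ (opp k) m := by
  rw [halfForm_apply]
  refine sum_mem fun j _ => N.mul_le (opp k) m (Sum.inr j) (Ideal.mul_mem_mul ?_ (hw _))
  have := hv (Sum.inl j)
  rwa [N.unitary] at this

theorem sum_sum_mem_of_symm {ι : Type*} (s : Finset ι) (G : AddSubgroup R) (f : ι → ι → R)
    (hf : ∀ k m, f k m = f m k) (h1 : ∀ k, f k k ∈ G) (h2 : ∀ k m, 2 * f k m ∈ G) :
    ∑ k ∈ s, ∑ m ∈ s, f k m ∈ G := by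
  classical
  induction s using Finset.induction_on with
  | empty => simp
  | insert a s ha ih =>
    have e : ∑ k ∈ insert a s, ∑ m ∈ insert a s, f k m =
        f a a + ∑ k ∈ s, 2 * f a k + ∑ k ∈ s, ∑ m ∈ s, f k m := by
      simp only [Finset.sum_insert ha, Finset.sum_add_distrib, ← Finset.mul_sum]
      simp only [hf _ a]
      ring
    rw [e]
    exact add_mem (add_mem (h1 a) (sum_mem fun k _ => h2 a k)) ih

/-- The family v has the same Gram matrix for B as the standard basis, so the differences of half
forms are symmetric in k, m. Diagonal terms lie in Γ_i since ξ²Γ_{-k} ⊆ Γ_i for ξ ∈ σ_{i,-k};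
off-diagonal terms occur twice and fall into 2σ_{i,-i} ⊆ Γ_i. -/
theorem halfForm_sum_mem {i : Idx n} {a : Idx n → R} (ha : ∀ k, a k ∈ N.σ k (opp i))
    (ha' : halfForm a a ∈ N.Γ i) {v : Idx n → Idx n → R} (hv : ∀ k l, v k l ∈ N.σ l k)
    (hv' : ∀ k, halfForm (v k) (v k) ∈ N.Γ (opp k))
    (hform : ∀ k m, form (v k) (v m) = form (ve k) (ve m)) :
    halfForm (∑ k, a k • v k) (∑ k, a k • v k) ∈ N.Γ i := by
  have hve : ∀ k l, (ve k : Idx n → R) l ∈ N.σ l k := fun k l => by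
    by_cases h : l = k
    · subst h; rw [N.diag]; trivial
    · rw [ve_of_ne h]; exact zero_mem _
  have expand : ∀ v : Idx n → Idx n → R, halfForm (∑ k, a k • v k) (∑ k, a k • v k) =
      ∑ k, ∑ m, a k * a m * halfForm (v k) (v m) := fun v => by
    simp only [map_sum, LinearMap.sum_apply, map_smul, LinearMap.smul_apply, smul_eq_mul,
      Finset.mul_sum]
    rw [Finset.sum_comm]
    refine Finset.sum_congr rfl fun k _ => Finset.sum_congr rfl fun m _ => ?_
    ring
  have h1 := expand ve
  rw [sum_smul_ve] at h1
  have h2 : halfForm (∑ k, a k • v k) (∑ k, a k • v k) = halfForm a a +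
      ∑ k, ∑ m, a k * a m * (halfForm (v k) (v m) - halfForm (ve k) (ve m)) := by
    rw [expand, h1, ← Finset.sum_add_distrib]
    refine Finset.sum_congr rfl fun k _ => ?_
    rw [← Finset.sum_add_distrib]
    exact Finset.sum_congr rfl fun m _ => by ring
  have ha2 : ∀ k, a k ∈ N.σ i (opp k) := fun k => by
    have := ha k
    rwa [N.unitary, opp_opp] at this
  rw [h2]
  refine add_mem ha' (sum_sum_mem_of_symm _ _ _ (fun k m => ?_) (fun k => ?_) fun k m => ?_)
  · have h3 := hform k m
    rw [form_eq_halfForm, form_eq_halfForm] at h3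
    linear_combination (a k * a m) * h3
  · have h3 : halfForm (ve k) (ve k : Idx n → R) = 0 := halfForm_self_eq_zero fun m => by
      by_cases h : m = k
      · right; rw [h]; exact ve_of_ne (ne_opp k).symm
      · left; exact ve_of_ne h
    rw [h3, sub_zero, ← pow_two]
    exact N.sq_mul_mem i (opp k) _ (ha2 k) _ (hv' k)
  · refine N.two_mul_mem i _ ?_
    have h3 := sub_mem (N.halfForm_mem (hv k) (hv m)) (N.halfForm_mem (hve k) (hve m))
    have h4 := N.mul_le _ _ _ (Ideal.mul_mem_mul (N.mul_le _ _ _ (Ideal.mul_mem_mul (ha2 k) h3))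
      (ha m))
    convert h4 using 1
    ring

theorem mul_mem_netSubgroup {g h : Sp n R} (hg : g ∈ N.netSubgroup) (hh : h ∈ N.netSubgroup) :
    g * h ∈ N.netSubgroup := by
  rw [mem_netSubgroup_iff] at hg hh ⊢
  refine ⟨fun i j => ?_, fun i => ?_⟩
  · rw [Submonoid.coe_mul, Matrix.mul_apply]
    exact sum_mem fun k _ => N.mul_le _ _ _ (Ideal.mul_mem_mul (hg.1 i k) (hh.1 k j))
  · rw [mul_inv_rev, act_mul]
    have h1 := N.halfForm_sum_mem (i := i) (a := act g⁻¹ (ve (opp i)))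
      (v := fun k => act h⁻¹ (ve k)) (fun k => N.act_inv_apply_mem hg.1 k _) (hg.2 i)
      (fun k l => N.act_inv_apply_mem hh.1 l k) (fun k => by simpa [opp_opp] using hh.2 (opp k))
      (fun k m => form_act _ _ _)
    rwa [show ∑ k, act g⁻¹ (ve (opp i)) k • act h⁻¹ (ve k) = act h⁻¹ (act g⁻¹ (ve (opp i))) by
      conv_rhs => rw [← sum_smul_ve (act g⁻¹ (ve (opp i)))]
      simp] at h1

theorem one_mem_netSubgroup : (1 : Sp n R) ∈ N.netSubgroup := by
  rw [mem_netSubgroup_iff]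
  refine ⟨fun i j => ?_, fun i => ?_⟩
  · by_cases h : i = j
    · subst h; rw [N.diag]; trivial
    · rw [Submonoid.coe_one, Matrix.one_apply_ne h]; exact zero_mem _
  · rw [inv_one, act_one, halfForm_self_eq_zero fun m => ?_]
    · exact zero_mem _
    by_cases h : m = opp i
    · right; rw [h]; exact ve_of_ne (ne_opp _).symm
    · left; exact ve_of_ne h

theorem IsElementary.inv {R' : Subring R} {F : FormNet n R'} {t : Sp n R} (h : F.IsElementary t) :
    F.IsElementary t⁻¹ := by
  cases h with
  | short s r h h' ξ hξ =>
    have e : (shortT s r h h' (ξ : R))⁻¹ = shortT s r h h' ((-ξ : R') : R) := by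
      have h1 := isTrans_shortT s r h h' (ξ : R)
      have h0 : form (ve (opp r) : Idx n → R) ((-sgn R r * (ξ : R)) • ve s) = 0 := by
        rw [map_smul, form_ve_ve (by rw [opp_opp]; exact h.symm), smul_zero]
      have h2 := (h1.symm.inv h0)
      rw [neg_zero] at h2
      refine h2.symm.unique (y := ve (opp r)) (α := 0) ?_
      convert isTrans_shortT s r h h' _ using 1
      push_cast
      module
    rw [e]
    exact .short s r h h' _ (neg_mem hξ)
  | long s α hα =>
    have e : (longT s (α : R))⁻¹ = longT s ((-α : R') : R) := by
      have h2 := (isTrans_longT s (α : R)).inv (by simp)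
      refine h2.unique ?_
      rw [neg_zero]
      convert isTrans_longT s _ using 1
      push_cast
      ring
    rw [e]
    exact .long s _ (neg_mem hα)

end FormNet

/-! ### Conjugates of elementary transvections and conclusion -/

namespace Setting

variable {n : ℕ} {R : Type*} [CommRing R] {A : Setting n R} [IsLocalRing R]

theorem mem_netSubgroup {b : Sp n R} {p q : Idx n → R} (hb : b ∈ A.H) (hpq : form p q = 0)
    (hbt : IsTrans b p q 0) : b ∈ A.net.netSubgroup := by
  rw [FormNet.mem_netSubgroup_iff]
  refine ⟨fun i j => ?_, fun i => ?_⟩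
  · rw [← act_ve]
    exact (inCol_act_ve hb hbt j).1 i
  · have h1 := hbt.inv hpq
    rw [neg_zero] at h1
    have h2 := (inCol_act_ve (inv_mem hb) h1 (opp i)).2
    rwa [opp_opp] at h2

theorem conj_mem_netSubgroup {a t : Sp n R} {x y : Idx n → R} (ha : a ∈ A.H) (ht : t ∈ A.H)
    (hxy : form x y = 0) (htt : IsTrans t x y 0) : a * t * a⁻¹ ∈ A.net.netSubgroup :=
  mem_netSubgroup (mul_mem (mul_mem ha ht) (inv_mem ha)) (by rw [form_act, hxy]) (htt.conj a)

/-- With k ∼ s, a long B at k, a short g sending e_k to e_k + e_s, and a short C, one has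
T_{s,-s}(α) = C⁻¹B⁻¹gBg⁻¹. Conjugating by a and regrouping as (aC⁻¹a⁻¹)((aB⁻¹)g(aB⁻¹)⁻¹)(ag⁻¹a⁻¹)
leaves only conjugates of short transvections by elements of H. -/
theorem conj_longT_mem_netSubgroup {a : Sp n R} (ha : a ∈ A.H) {s : Idx n} {α : A.R'}
    (hα : α ∈ A.F.Γ s) : a * longT s (α : R) * a⁻¹ ∈ A.net.netSubgroup := by
  obtain ⟨k, hsk, hks, hks'⟩ : ∃ k, A.ν s k ∧ k ≠ s ∧ k ≠ opp s := by
    by_cases hs : A.ν s (opp s)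
    · exact A.exists_rel_of_self hs
    · obtain ⟨k, hk, hkn⟩ := A.exists_rel_of_not_self hs {s, opp s}
        (Finset.card_le_two.trans_lt (by norm_num))
      simp only [Finset.mem_insert, Finset.mem_singleton, not_or] at hkn
      exact ⟨k, hk, hkn⟩
  have hsk' : s ≠ opp k := fun h => hks' (by rw [h, opp_opp])
  have sk := sgn_mul_self (R := R) k
  obtain ⟨g, hg, hgv⟩ := A.exists_short hks.symm hsk' hsk
  have hgt : IsTrans g (ve s) ((-sgn R k) • ve (opp k)) 0 := fun v => by
    rw [hgv]
    simp only [map_smul, LinearMap.smul_apply, form_ve_left, opp_opp, sgn_opp, smul_eq_mul]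
    rw [show -sgn R k * (-sgn R k * v k) = v k by linear_combination (v k) * sk]
    module
  have hg0 : form (ve s) ((-sgn R k) • ve (opp k) : Idx n → R) = 0 := by
    rw [map_smul, form_ve_ve fun h => hks ((opp_eq_iff _ _).1 h).symm, smul_zero]
  have hgk : act g (ve k) = ve k + ve s := by
    rw [hgv, ve_self, ve_of_ne fun h => hks' h.symm]
    simp
  obtain ⟨u, hu⟩ := A.exists_coe_eq_sgn k
  obtain ⟨w, hw⟩ := A.exists_coe_eq_sgn s
  -- The sign ε_k ε_s gives the long transvections at k and s the same parameter in the
  -- normalization of `IsTrans`.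
  have hα' : u * w * α ∈ A.F.Γ k := by
    have h1 := A.F.sq_mul_mem k s 1 (by rw [A.sigma_F_eq_top (A.ν.symm' hsk)]; trivial) α hα
    rw [one_pow, one_mul] at h1
    have h2 : u * w = 1 ∨ u * w = -1 := by
      rcases k with k | k <;> rcases s with s | s
      · left; exact Subtype.ext (by simp [hu, hw, sgn])
      · right; exact Subtype.ext (by simp [hu, hw, sgn])
      · right; exact Subtype.ext (by simp [hu, hw, sgn])
      · left; exact Subtype.ext (by simp [hu, hw, sgn])
    rcases h2 with h2 | h2
    · rwa [h2, one_mul]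
    · rw [h2, neg_one_mul]; exact neg_mem h1
  have hB := A.longT_mem hα'
  have hBt := isTrans_longT k ((u * w * α : A.R') : R)
  have hβ : sgn R k * ((u * w * α : A.R') : R) = sgn R s * α := by
    push_cast
    rw [hu, hw]
    linear_combination (sgn R s * (α : R)) * sk
  rw [hβ] at hBt
  have hξ : α ∈ A.F.σ k (opp s) := by
    have h1 := A.F.mul_le k (opp s) s (Ideal.mul_mem_mul (r := 1)
      (by rw [A.sigma_F_eq_top (A.ν.symm' hsk)]; trivial) (A.F.mem_of_mem s α hα))
    rwa [one_mul] at h1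
  obtain ⟨C, hC, hCt⟩ : ∃ C ∈ A.H, IsTrans C ((-sgn R (opp s) * (α : R)) • ve k)
      (ve (opp (opp s))) 0 :=
    ⟨_, A.shortT_mem hks' (by rwa [opp_opp]) hξ, isTrans_shortT _ _ _ _ _⟩
  rw [sgn_opp, neg_neg, opp_opp, IsTrans.smul_left, mul_zero] at hCt
  have hks0 : form (ve k) (ve s : Idx n → R) = 0 := form_ve_ve fun h => hsk' h.symm
  set B := longT k ((u * w * α : A.R') : R)
  have hBg := hBt.conj g
  rw [hgk, map_zero] at hBg
  have key := IsTrans.of_add hks0 hBt hBg hCt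
  have e : longT s (α : R) = C⁻¹ * B⁻¹ * (g * B * g⁻¹) := (isTrans_longT s _).unique key
  have hC0 : form (ve k : Idx n → R) ((sgn R s * (α : R)) • ve s) = 0 := by rw [map_smul, hks0, smul_zero]
  have m1 : a * C⁻¹ * a⁻¹ ∈ A.net.netSubgroup :=
    conj_mem_netSubgroup ha (inv_mem hC) (by rw [map_neg, hC0, neg_zero])
      (by simpa using hCt.inv hC0)
  have m2 : (a * B⁻¹) * g * (a * B⁻¹)⁻¹ ∈ A.net.netSubgroup :=
    conj_mem_netSubgroup (mul_mem ha (inv_mem hB)) hg hg0 hgt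
  have m3 : a * g⁻¹ * a⁻¹ ∈ A.net.netSubgroup :=
    conj_mem_netSubgroup ha (inv_mem hg) (by rw [map_neg, hg0, neg_zero])
      (by simpa using hgt.inv hg0)
  have := A.net.mul_mem_netSubgroup (A.net.mul_mem_netSubgroup m1 m2) m3
  rw [e]
  convert this using 1
  group

theorem conj_elementary_mem_netSubgroup {a t : Sp n R} (ha : a ∈ A.H) (ht : A.F.IsElementary t) :
    a * t * a⁻¹ ∈ A.net.netSubgroup := by
  cases ht with
  | short s r h h' ξ hξ =>
    refine conj_mem_netSubgroup ha (A.shortT_mem h h' hξ) ?_ (isTrans_shortT s r h h' (ξ : R))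
    rw [map_smul, LinearMap.smul_apply, form_ve_ve fun he => h ((opp_eq_iff _ _).1 he), smul_zero]
  | long s α hα => exact conj_longT_mem_netSubgroup ha hα

theorem subset_transporter :
    (A.H : Set (Sp n R)) ⊆ transporter A.F.elementarySubgroup A.net.netSubgroup := by
  intro a ha τ hτ
  induction hτ using Subgroup.closure_induction'' with
  | mem t ht => exact conj_elementary_mem_netSubgroup ha ht
  | inv_mem t ht => exact conj_elementary_mem_netSubgroup ha ht.inv
  | one => simpa using A.net.one_mem_netSubgroup
  | mul x y _ _ hx hy =>
    have := A.net.mul_mem_netSubgroup hx hy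
    convert this using 1
    group

end Setting

end SpNet

theorem mainTheorem3 {R : Type*} [CommRing R] [IsLocalRing R]
    (R' : Subring R) (S : Set R) (hS : SpNet.IsStandardSetting R' S)
    (n : ℕ) (ν : Setoid (SpNet.Idx n)) (hν : SpNet.IsUnitary ν)
    (hh : ((4, 5) : ℕ∞ × ℕ∞) ≤ SpNet.height ν)
    (H : Subgroup (SpNet.Sp n R))
    (F : SpNet.FormNet n R') (hexact : F.IsExact) (hmajor : F.IsMajor ν hν)
    (hassoc : F.IsAssociated S H) :
    (∀ a ∈ H, ∀ t : SpNet.Sp n R, F.IsElementary t →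
      a * t * a⁻¹ ∈ (F.sClosure hS).netSubgroup) ∧
    (H : Set (SpNet.Sp n R)) ⊆
      SpNet.transporter F.elementarySubgroup (F.sClosure hS).netSubgroup := by
  let A : SpNet.Setting n R := ⟨R', S, hS, ν, hν, hh, H, F, hmajor, hassoc⟩
  exact ⟨fun a ha t ht => SpNet.Setting.conj_elementary_mem_netSubgroup (A := A) ha ht,
    SpNet.Setting.subset_transporter (A := A)⟩
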